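/- Let $C$ be a $C^*$-algebra. All Hilbert $C$-modules below are finitely generated projective and all operators are bounded and adjointable. An $n$-dimensional algebraic Hilbert–Poincaré complex is a triple $(E,b,S)$, where $E=\bigoplus_{k=0}^{n}E^{(k)}$ is an orthogonal direct sum of Hilbert $C$-modules, $b:E\to E$ maps $E^{(k)}$ to $E^{(k-1)}$ (and $E^{(0)}$ to $0$) with $b^2=0$, and $S=S^*:E\to E$ maps $E^{(n-k)}$ to $E^{(k)}$, satisfies $bS+Sb^*=0$, and induces an isomorphism from the homology of $(E,b^*)$ to the homology of $(E,b)$. Its Mishchenko signature is $[Q_+]-[Q_-]\in K_0(C)$. Here $b_S=\begin{pmatrix} b^*&0\\ S&b\end{pmatrix}$ on $E\oplus E$ is the differential of the mapping cone of $S:(E,-b^*)\to(E,b)$, the operator $B_S=b_S^*+b_S$ is self-adjoint and invertible, and $Q_\pm$ are the positive and negative spectral projections of the restriction of $B_S$ to the $+1$ eigenspace of the symmetry that exchanges the two summands of $E\oplus E$. For $n$ even, its Higson–Roe signature is $[P_+]-[P_-]\in K_0(C)$, where $P_+$ and $P_-$ are the positive spectral projections of the invertible self-adjoint operators $b+b^*+S$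 and $b+b^*-S$, respectively. An $(n+1)$-dimensional algebraic Hilbert–Poincaré complex with boundary consists of an $(n+1)$-dimensional chain complex $(E,b)$ of Hilbert $C$-modules as above, an $n$-dimensional subcomplex $(E_0,b_0)\subset(E,b)$ that is an orthogonal direct summand $E=E_0\oplus E_1$ of $E$ as a graded module (so $b|_{E_0}=b_0$), and a self-adjoint operator $S:E\to E$ that maps $E^{(n+1-k)}$ to $E^{(k)}$, such that $(bS+Sb^*)(E)\subset E_0$ and such that $S$, followed by the quotient map $E\to E/E_0$, induces an isomorphism from the homology of $(E,b^*)$ to the homology of the quotient complex $(E/E_0,b_1)$, where $b_1$ is the differential induced by $b$ on $E/E_0\cong E_1$. Theorem. For every $n\ge 0$ and every $(n+1)$-dimensional algebraic Hilbert–Poincaré complex with boundary, put $S_0=(bS+Sb^*)|_{E_0}:E_0\to E_0$. Then $(E_0,\sqrt{-1}\,b_0,S_0)$ is an $n$-dimensional algebraic Hilbert–Poincaré complex, and its signature is zero in $K_0(C)$: its Mishchenko signature is $0$, and, if $n$ is even, its Higson–Roe signature is $0$. -/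

import Mathlib

/-!
Throughout, a Hilbert `C`-module over a (not necessarily unital) C⋆-algebra `C` is Mathlib's
`CStarModule C E` on a complete normed space `E`; the `C`-valued inner product is `inner C x y`,
conjugate-linear in `x`, linear in `y`, and `inner C x (a • y) = a * inner C x y`.
-/

namespace HilbertPoincare

/-! ### The group `K₀` -/

section KTheory

universe u v

/-- An idempotent square matrix of finite size over a ring. -/
structure IdempotentMatrix (R : Type u) [Ring R] where
  size : ℕ
  mat : Matrix (Fin size) (Fin size) R
  idem : mat * mat = mat

/-- Algebraic (Murray-von Neumann) equivalence of square matrices `e`, `f` of possibly different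
sizes: `e = a * b` and `f = b * a` for some rectangular matrices `a`, `b`. -/
def MatrixEquivalent {R : Type u} [Ring R] {ι κ : Type*} [Fintype ι] [Fintype κ]
    (e : Matrix ι ι R) (f : Matrix κ κ R) : Prop :=
  ∃ (a : Matrix ι κ R) (b : Matrix κ ι R), a * b = e ∧ b * a = f

theorem MatrixEquivalent.refl {R : Type u} [Ring R] {ι : Type*} [Fintype ι]
    {e : Matrix ι ι R} (he : e * e = e) : MatrixEquivalent e e := ⟨e, e, he, he⟩

theorem MatrixEquivalent.symm {R : Type u} [Ring R] {ι κ : Type*} [Fintype ι] [Fintype κ]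
    {e : Matrix ι ι R} {f : Matrix κ κ R} (h : MatrixEquivalent e f) : MatrixEquivalent f e := by
  obtain ⟨a, b, hab, hba⟩ := h
  exact ⟨b, a, hba, hab⟩

theorem MatrixEquivalent.trans {R : Type u} [Ring R] {ι κ l : Type*} [Fintype ι] [Fintype κ]
    [Fintype l] {e : Matrix ι ι R} {f : Matrix κ κ R} {g : Matrix l l R}
    (he : e * e = e) (hg : g * g = g)
    (h₁ : MatrixEquivalent e f) (h₂ : MatrixEquivalent f g) : MatrixEquivalent e g := by
  obtain ⟨a, b, hab, hba⟩ := h₁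
  obtain ⟨c, d, hcd, hdc⟩ := h₂
  refine ⟨a * c, d * b, ?_, ?_⟩
  · calc a * c * (d * b) = a * (c * d) * b := by simp only [Matrix.mul_assoc]
      _ = (a * b) * (a * b) := by rw [hcd, ← hba]; simp only [Matrix.mul_assoc]
      _ = e := by rw [hab, he]
  · calc d * b * (a * c) = d * (b * a) * c := by simp only [Matrix.mul_assoc]
      _ = (d * c) * (d * c) := by rw [hba, ← hcd]; simp only [Matrix.mul_assoc]
      _ = g := by rw [hdc, hg]

/-- Renaming the indices of an idempotent matrix does not change its class. -/
theorem MatrixEquivalent.reindex {R : Type u} [Ring R] {ι κ : Type*} [Fintype ι] [Fintype κ]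
    (σ : ι ≃ κ) {e : Matrix ι ι R} (he : e * e = e) :
    MatrixEquivalent (Matrix.reindex σ σ e) e := by
  refine ⟨e.submatrix σ.symm id, e.submatrix id σ.symm, ?_, ?_⟩
  · rw [← Matrix.submatrix_mul e e σ.symm id σ.symm Function.bijective_id, he]
    rfl
  · rw [← Matrix.submatrix_mul e e id σ.symm id σ.symm.bijective, he]
    rfl

theorem MatrixEquivalent.fromBlocks {R : Type u} [Ring R] {ι κ ι' κ' : Type*}
    [Fintype ι] [Fintype κ] [Fintype ι'] [Fintype κ']
    {e : Matrix ι ι R} {e' : Matrix ι' ι' R} {f : Matrix κ κ R} {f' : Matrix κ' κ' R}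
    (h : MatrixEquivalent e e') (h' : MatrixEquivalent f f') :
    MatrixEquivalent (Matrix.fromBlocks e 0 0 f) (Matrix.fromBlocks e' 0 0 f') := by
  obtain ⟨a, b, rfl, rfl⟩ := h
  obtain ⟨c, d, rfl, rfl⟩ := h'
  refine ⟨Matrix.fromBlocks a 0 0 c, Matrix.fromBlocks b 0 0 d, ?_, ?_⟩ <;>
    simp [Matrix.fromBlocks_multiply]

theorem fromBlocks_idem {R : Type u} [Ring R] {ι κ : Type*} [Fintype ι] [Fintype κ]
    {e : Matrix ι ι R} {f : Matrix κ κ R} (he : e * e = e) (hf : f * f = f) :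
    Matrix.fromBlocks e 0 0 f * Matrix.fromBlocks e 0 0 f = Matrix.fromBlocks e 0 0 f := by
  simp [Matrix.fromBlocks_multiply, he, hf]

theorem reindex_idem {R : Type u} [Ring R] {ι κ : Type*} [Fintype ι] [Fintype κ] (σ : ι ≃ κ)
    {e : Matrix ι ι R} (he : e * e = e) :
    Matrix.reindex σ σ e * Matrix.reindex σ σ e = Matrix.reindex σ σ e := by
  simp only [Matrix.reindex_apply]
  rw [← Matrix.submatrix_mul e e σ.symm σ.symm σ.symm σ.symm.bijective, he]

namespace IdempotentMatrix

variable {R : Type u} [Ring R]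

instance instSetoid : Setoid (IdempotentMatrix R) where
  r e f := MatrixEquivalent e.mat f.mat
  iseqv :=
    { refl := fun e => MatrixEquivalent.refl e.idem
      symm := fun h => h.symm
      trans := fun {e _ g} h₁ h₂ => MatrixEquivalent.trans e.idem g.idem h₁ h₂ }

/-- The block sum `diag(e, f)`. -/
def blockSum (e f : IdempotentMatrix R) : IdempotentMatrix R where
  size := e.size + f.size
  mat := Matrix.reindex finSumFinEquiv finSumFinEquiv (Matrix.fromBlocks e.mat 0 0 f.mat)
  idem := reindex_idem _ (fromBlocks_idem e.idem f.idem)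

theorem blockSum_equiv (e f : IdempotentMatrix R) :
    MatrixEquivalent (blockSum e f).mat (Matrix.fromBlocks e.mat 0 0 f.mat) :=
  MatrixEquivalent.reindex _ (fromBlocks_idem e.idem f.idem)

/-- The empty matrix. -/
def empty : IdempotentMatrix R where
  size := 0
  mat := 0
  idem := by simp

/-- Entrywise image under a ring homomorphism. -/
def map {R' : Type v} [Ring R'] (φ : R →+* R') (e : IdempotentMatrix R) : IdempotentMatrix R' where
  size := e.size
  mat := e.mat.map φ
  idem := by rw [← Matrix.map_mul, e.idem]

end IdempotentMatrix

/-- Equivalence classes of idempotent matrices over `R` (equivalently, isomorphism classes of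
finitely generated projective `R`-modules). -/
def IdempotentClass (R : Type u) [Ring R] : Type u :=
  Quotient (IdempotentMatrix.instSetoid (R := R))

namespace IdempotentClass

variable {R : Type u} [Ring R]

/-- The class of an idempotent matrix. -/
def mk (e : IdempotentMatrix R) : IdempotentClass R := Quotient.mk _ e

theorem mk_eq_mk {e f : IdempotentMatrix R} (h : MatrixEquivalent e.mat f.mat) : mk e = mk f :=
  Quotient.sound h

instance instAdd : Add (IdempotentClass R) where
  add := Quotient.map₂ IdempotentMatrix.blockSum (by
    intro e e' h f f' h'
    exact MatrixEquivalent.trans (IdempotentMatrix.blockSum e f).idem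
      (IdempotentMatrix.blockSum e' f').idem (IdempotentMatrix.blockSum_equiv e f)
      (MatrixEquivalent.trans (fromBlocks_idem e.idem f.idem)
        (IdempotentMatrix.blockSum e' f').idem (MatrixEquivalent.fromBlocks h h')
        (IdempotentMatrix.blockSum_equiv e' f').symm))

instance instZero : Zero (IdempotentClass R) where
  zero := mk IdempotentMatrix.empty

theorem mk_add_mk (e f : IdempotentMatrix R) : mk e + mk f = mk (e.blockSum f) := rfl

theorem mk_eq_zero (e : IdempotentMatrix R) (h : e.mat = 0) : mk e = 0 := by
  refine mk_eq_mk ⟨0, 0, ?_, ?_⟩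
  · simp [h]
  · exact Matrix.ext (fun i => i.elim0)

/-- A block sum is determined up to equivalence by its blocks. -/
theorem mk_blockSum_eq {e f g : IdempotentMatrix R}
    (h : MatrixEquivalent (Matrix.fromBlocks e.mat 0 0 f.mat) g.mat) : mk e + mk f = mk g :=
  mk_eq_mk (MatrixEquivalent.trans (IdempotentMatrix.blockSum e f).idem g.idem
    (IdempotentMatrix.blockSum_equiv e f) h)

protected theorem add_comm (x y : IdempotentClass R) : x + y = y + x := by
  induction x using Quotient.inductionOn with | _ e
  induction y using Quotient.inductionOn with | _ f
  refine mk_blockSum_eq (MatrixEquivalent.trans (fromBlocks_idem e.idem f.idem)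
    (f.blockSum e).idem ?_ (f.blockSum_equiv e).symm)
  refine ⟨Matrix.fromBlocks 0 e.mat f.mat 0, Matrix.fromBlocks 0 f.mat e.mat 0, ?_, ?_⟩ <;>
    simp [Matrix.fromBlocks_multiply, e.idem, f.idem]

protected theorem zero_add (x : IdempotentClass R) : 0 + x = x := by
  induction x using Quotient.inductionOn with | _ e
  refine mk_blockSum_eq (e := IdempotentMatrix.empty) (f := e)
    ⟨Matrix.fromRows 0 e.mat, Matrix.fromCols 0 e.mat, ?_, ?_⟩
  · rw [Matrix.fromRows_mul_fromCols]
    have z1 : (0 : Matrix (Fin IdempotentMatrix.empty.size) (Fin e.size) R) *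
        (0 : Matrix (Fin e.size) (Fin IdempotentMatrix.empty.size) R) =
        (IdempotentMatrix.empty (R := R)).mat := by ext i; exact i.elim0
    rw [z1, e.idem, Matrix.zero_mul, Matrix.mul_zero]
  · rw [Matrix.fromCols_mul_fromRows]
    simp [e.idem]

protected theorem add_assoc (x y z : IdempotentClass R) : x + y + z = x + (y + z) := by
  induction x using Quotient.inductionOn with | _ e
  induction y using Quotient.inductionOn with | _ f
  induction z using Quotient.inductionOn with | _ g
  have h₁ := MatrixEquivalent.fromBlocks (e.blockSum_equiv f) (MatrixEquivalent.refl g.idem)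
  have h₂ := MatrixEquivalent.fromBlocks (MatrixEquivalent.refl e.idem) (f.blockSum_equiv g)
  have i₁ := fromBlocks_idem (fromBlocks_idem e.idem f.idem) g.idem
  have i₂ := fromBlocks_idem e.idem (fromBlocks_idem f.idem g.idem)
  refine mk_blockSum_eq (e := e.blockSum f) (f := g) ?_
  refine MatrixEquivalent.trans (fromBlocks_idem (e.blockSum f).idem g.idem)
    (e.blockSum (f.blockSum g)).idem h₁ ?_
  refine MatrixEquivalent.trans i₁ (e.blockSum (f.blockSum g)).idem ?_
    (e.blockSum_equiv (f.blockSum g)).symm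
  refine MatrixEquivalent.trans i₁ (fromBlocks_idem e.idem (f.blockSum g).idem) ?_ h₂.symm
  have key : Matrix.reindex (Equiv.sumAssoc _ _ _) (Equiv.sumAssoc _ _ _)
      (Matrix.fromBlocks (Matrix.fromBlocks e.mat 0 0 f.mat) 0 0 g.mat) =
      Matrix.fromBlocks e.mat 0 0 (Matrix.fromBlocks f.mat 0 0 g.mat) := by
    ext i j
    rcases i with i | i | i <;> rcases j with j | j | j <;> rfl
  rw [← key]
  exact (MatrixEquivalent.reindex _ i₁).symm

instance instAddCommMonoid : AddCommMonoid (IdempotentClass R) where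
  add_assoc := IdempotentClass.add_assoc
  zero_add := IdempotentClass.zero_add
  add_zero x := by rw [IdempotentClass.add_comm, IdempotentClass.zero_add]
  add_comm := IdempotentClass.add_comm
  nsmul := nsmulRec

/-- Functoriality. -/
def map {R' : Type v} [Ring R'] (φ : R →+* R') : IdempotentClass R →+ IdempotentClass R' where
  toFun := Quotient.map (IdempotentMatrix.map φ) (by
    rintro e f ⟨a, b, hab, hba⟩
    refine ⟨a.map φ, b.map φ, ?_, ?_⟩
    · exact Matrix.map_mul.symm.trans (congrArg (fun M => Matrix.map M φ) hab)
    · exact Matrix.map_mul.symm.trans (congrArg (fun M => Matrix.map M φ) hba))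
  map_zero' := mk_eq_zero _ (by ext i; exact i.elim0)
  map_add' x y := by
    induction x using Quotient.inductionOn with | _ e
    induction y using Quotient.inductionOn with | _ f
    have hm : ((e.blockSum f).map φ).mat = ((e.map φ).blockSum (f.map φ)).mat := by
      ext i j
      change φ (Matrix.fromBlocks e.mat 0 0 f.mat (finSumFinEquiv.symm i) (finSumFinEquiv.symm j)) =
        Matrix.fromBlocks (e.mat.map φ) 0 0 (f.mat.map φ)
          (finSumFinEquiv.symm i) (finSumFinEquiv.symm j)
      rcases finSumFinEquiv.symm i with i | i <;> rcases finSumFinEquiv.symm j with j | j <;> simp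
    refine mk_eq_mk (e := (e.blockSum f).map φ) (f := (e.map φ).blockSum (f.map φ)) ?_
    rw [hm]
    exact MatrixEquivalent.refl ((e.map φ).blockSum (f.map φ)).idem

end IdempotentClass

/-- `K₀` of a unital ring: the Grothendieck group of classes of idempotent matrices. -/
abbrev UnitalK0 (R : Type u) [Ring R] : Type u := Algebra.GrothendieckAddGroup (IdempotentClass R)

/-- The class `[e]` in `K₀` of an idempotent matrix. -/
def UnitalK0.mk {R : Type u} [Ring R] (e : IdempotentMatrix R) : UnitalK0 R :=
  Algebra.GrothendieckAddGroup.of (IdempotentClass.mk e)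

/-- Functoriality of `K₀` for unital ring homomorphisms. -/
noncomputable def UnitalK0.map {R : Type u} [Ring R] {R' : Type v} [Ring R'] (φ : R →+* R') :
    UnitalK0 R →+ UnitalK0 R' :=
  Algebra.GrothendieckAddGroup.lift
    ((Algebra.GrothendieckAddGroup.of (M := IdempotentClass R')).comp (IdempotentClass.map φ))

/-- `K₀` of a possibly non-unital C⋆-algebra `C`: the kernel of the map `K₀(C⁺) → K₀(ℂ)` induced by
the canonical character of the unitization `C⁺`. For unital `C` it is the usual `K₀(C)`. -/
noncomputable def K0 (C : Type u) [NonUnitalCStarAlgebra C] :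
    AddSubgroup (UnitalK0 (Unitization ℂ C)) :=
  (UnitalK0.map (Unitization.fstHom ℂ C).toRingHom).ker

theorem UnitalK0.mk_mem_K0 {C : Type u} [NonUnitalCStarAlgebra C]
    (e : IdempotentMatrix (Unitization ℂ C)) (h : ∀ i k, (e.mat i k).fst = 0) :
    UnitalK0.mk e ∈ K0 C := by
  have h0 : IdempotentClass.map (Unitization.fstHom ℂ C).toRingHom (IdempotentClass.mk e) = 0 :=
    IdempotentClass.mk_eq_zero _ (by ext i k; exact h i k)
  have h1 : UnitalK0.map (Unitization.fstHom ℂ C).toRingHom (UnitalK0.mk e) =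
      Algebra.GrothendieckAddGroup.of
        (IdempotentClass.map (Unitization.fstHom ℂ C).toRingHom (IdempotentClass.mk e)) := by
    have := Algebra.GrothendieckAddGroup.lift.symm_apply_apply
      ((Algebra.GrothendieckAddGroup.of (M := IdempotentClass ℂ)).comp
        (IdempotentClass.map (Unitization.fstHom ℂ C).toRingHom))
    exact DFunLike.congr_fun this (IdempotentClass.mk e)
  rw [K0, AddMonoidHom.mem_ker, h1, h0, map_zero]

end KTheory

/-! ### Adjointable operators on Hilbert modules -/

section Modules

open WithCStarModule

/-- A bounded adjointable operator `E → F` between Hilbert `C`-modules, together with its (unique)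
adjoint. Such an operator is automatically `C`-linear. -/
@[ext]
structure Adjointable (C : Type*) (E F : Type*) [NonUnitalCStarAlgebra C] [PartialOrder C]
    [NormedAddCommGroup E] [NormedSpace ℂ E] [SMul C E] [CStarModule C E]
    [NormedAddCommGroup F] [NormedSpace ℂ F] [SMul C F] [CStarModule C F] where
  op : E →L[ℂ] F
  adj : F →L[ℂ] E
  inner_op : ∀ (x : E) (y : F), inner C (op x) y = inner C x (adj y)

variable {C : Type*} [NonUnitalCStarAlgebra C] [PartialOrder C]
  {E : Type*} [NormedAddCommGroup E] [NormedSpace ℂ E] [SMul C E] [CStarModule C E]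
  {F : Type*} [NormedAddCommGroup F] [NormedSpace ℂ F] [SMul C F] [CStarModule C F]
  {G : Type*} [NormedAddCommGroup G] [NormedSpace ℂ G] [SMul C G] [CStarModule C G]

namespace Adjointable

instance instCoeFun : CoeFun (Adjointable C E F) (fun _ => E → F) := ⟨fun T => T.op⟩

/-- The adjoint operator `T*`. -/
def adjoint (T : Adjointable C E F) : Adjointable C F E where
  op := T.adj
  adj := T.op
  inner_op x y := by rw [← CStarModule.star_inner, ← T.inner_op, CStarModule.star_inner]

/-- Composition of operators. -/
def comp (T : Adjointable C F G) (U : Adjointable C E F) : Adjointable C E G where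
  op := T.op.comp U.op
  adj := U.adj.comp T.adj
  inner_op x y := by
    rw [ContinuousLinearMap.comp_apply, T.inner_op, U.inner_op, ContinuousLinearMap.comp_apply]

variable (C E) in
/-- The identity operator. -/
def id : Adjointable C E E where
  op := ContinuousLinearMap.id ℂ E
  adj := ContinuousLinearMap.id ℂ E
  inner_op _ _ := rfl

instance instZero : Zero (Adjointable C E F) where
  zero :=
    { op := 0
      adj := 0
      inner_op := fun x y => by simp }

instance instAdd : Add (Adjointable C E F) where
  add T U :=
    { op := T.op + U.op
      adj := T.adj + U.adj
      inner_op := fun x y => by simp [T.inner_op, U.inner_op] }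

instance instNeg : Neg (Adjointable C E F) where
  neg T :=
    { op := -T.op
      adj := -T.adj
      inner_op := fun x y => by simp [T.inner_op] }

instance instSub : Sub (Adjointable C E F) where
  sub T U :=
    { op := T.op - U.op
      adj := T.adj - U.adj
      inner_op := fun x y => by simp [T.inner_op, U.inner_op] }

instance instSMul : SMul ℂ (Adjointable C E F) where
  smul z T :=
    { op := z • T.op
      adj := star z • T.adj
      inner_op := fun x y => by simp [T.inner_op] }

/-- An adjointable operator is `C`-linear. -/
theorem map_smul_alg (T : Adjointable C E F) (a : C) (x : E) : T (a • x) = a • T x := by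
  have h : ∀ w : F, inner C w (T (a • x)) = inner C w (a • T x) := by
    intro w
    have hT : ∀ y : E, inner C w (T y) = inner C (T.adj w) y := fun y =>
      (T.adjoint.inner_op w y).symm
    rw [hT, CStarModule.inner_op_smul_right, CStarModule.inner_op_smul_right, hT]
  have h0 : inner C (T (a • x) - a • T x) (T (a • x) - a • T x) = 0 := by
    rw [CStarModule.inner_sub_right, h, sub_self]
  exact sub_eq_zero.mp (CStarModule.inner_self.mp h0)

variable [StarOrderedRing C]

variable (C E F) in
/-- The underlying pair of an element of the orthogonal direct sum `E ⊕ F`. -/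
noncomputable def toProd : WithCStarModule C (E × F) →L[ℂ] E × F :=
  (equivL ℂ (A := C) (E := E × F)).toContinuousLinearMap

variable (C E F) in
/-- A pair as an element of the orthogonal direct sum `E ⊕ F`. -/
noncomputable def ofProd : E × F →L[ℂ] WithCStarModule C (E × F) :=
  (equivL ℂ (A := C) (E := E × F)).symm.toContinuousLinearMap

/-- The operator on the orthogonal direct sum of Hilbert modules with block matrix
`!![a, b; c, d]`, that is `(x, y) ↦ (a x + b y, c x + d y)`. -/
noncomputable def block (a : Adjointable C E E) (b : Adjointable C F E) (c : Adjointable C E F)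
    (d : Adjointable C F F) :
    Adjointable C (WithCStarModule C (E × F)) (WithCStarModule C (E × F)) where
  op := (ofProd C E F).comp
    (((a.op.comp (.fst ℂ E F) + b.op.comp (.snd ℂ E F)).prod
      (c.op.comp (.fst ℂ E F) + d.op.comp (.snd ℂ E F))).comp (toProd C E F))
  adj := (ofProd C E F).comp
    (((a.adj.comp (.fst ℂ E F) + c.adj.comp (.snd ℂ E F)).prod
      (b.adj.comp (.fst ℂ E F) + d.adj.comp (.snd ℂ E F))).comp (toProd C E F))
  inner_op x y := by
    rw [prod_inner, prod_inner]
    change inner C (a x.1 + b x.2) y.1 + inner C (c x.1 + d x.2) y.2 =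
      inner C x.1 (a.adj y.1 + c.adj y.2) + inner C x.2 (b.adj y.1 + d.adj y.2)
    simp only [CStarModule.inner_add_left, CStarModule.inner_add_right, a.inner_op, b.inner_op,
      c.inner_op, d.inner_op]
    abel

theorem block_fst (a : Adjointable C E E) (b : Adjointable C F E) (c : Adjointable C E F)
    (d : Adjointable C F F) (x : WithCStarModule C (E × F)) :
    (block a b c d x).1 = a x.1 + b x.2 := rfl

theorem block_snd (a : Adjointable C E E) (b : Adjointable C F E) (c : Adjointable C E F)
    (d : Adjointable C F F) (x : WithCStarModule C (E × F)) :
    (block a b c d x).2 = c x.1 + d x.2 := rfl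

end Adjointable

/-! ### Finitely generated projective modules and their classes -/

variable (C E) in
/-- A finite dual basis `x₁, …, xₘ; ⟨y₁, ·⟩, …, ⟨yₘ, ·⟩` of the Hilbert `C`-module `E`:
every `v` equals `∑ ⟨yᵢ, v⟩ xᵢ`. -/
structure DualBasis (m : ℕ) where
  x : Fin m → E
  y : Fin m → E
  expand : ∀ v : E, ∑ i, (inner C (y i) v : C) • x i = v

variable (C E) in
/-- A Hilbert `C`-module is finitely generated projective if it has a finite dual basis. -/
def IsFGProjective : Prop := ∃ m : ℕ, Nonempty (DualBasis C E m)

theorem DualBasis.sum_inner_mul_inner {F' : Type*} [NormedAddCommGroup F'] [NormedSpace ℂ F']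
    [SMul C F'] [CStarModule C F'] {m : ℕ} (β : DualBasis C E m) (T : Adjointable C E F')
    (v : E) (w : F') :
    ∑ i, inner C (β.y i) v * inner C w (T (β.x i)) = inner C w (T v) := by
  conv_rhs => rw [← β.expand v, map_sum, CStarModule.inner_sum_right]
  refine Finset.sum_congr rfl fun i _ => ?_
  rw [T.map_smul_alg, CStarModule.inner_op_smul_right]

/-- The matrix of an idempotent operator `P` in a dual basis. Its entries lie in `C`, seen inside
the unitization of `C`. The finitely generated projective module it defines is `P E`. -/
noncomputable def projectionMatrix {m : ℕ} (β : DualBasis C E m) (P : Adjointable C E E)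
    (hP : ∀ v, P (P v) = P v) : IdempotentMatrix (Unitization ℂ C) where
  size := m
  mat := Matrix.of fun i k => ((inner C (β.y k) (P (β.x i)) : C) : Unitization ℂ C)
  idem := by
    ext1 i k
    simp only [Matrix.mul_apply, Matrix.of_apply, ← Unitization.inr_mul]
    refine (map_sum (Unitization.inrNonUnitalStarAlgHom ℂ C)
      (fun j => inner C (β.y j) (P (β.x i)) * inner C (β.y k) (P (β.x j))) Finset.univ).symm.trans ?_
    rw [β.sum_inner_mul_inner P (P (β.x i)) (β.y k), hP]
    rfl

/-- The class `[P E]` in `K₀(C)` of an idempotent operator `P` on `E`. -/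
noncomputable def projectionClass {m : ℕ} (β : DualBasis C E m) (P : Adjointable C E E)
    (hP : ∀ v, P (P v) = P v) : K0 C :=
  ⟨UnitalK0.mk (projectionMatrix β P hP), UnitalK0.mk_mem_K0 _ fun _ _ => Unitization.fst_inr _ _⟩

/-- The class `[P E]` does not depend on the dual basis. -/
theorem projectionClass_eq {m m' : ℕ} (β : DualBasis C E m) (β' : DualBasis C E m')
    (P : Adjointable C E E) (hP : ∀ v, P (P v) = P v) :
    projectionClass β P hP = projectionClass β' P hP := by
  refine Subtype.ext (congrArg Algebra.GrothendieckAddGroup.of (IdempotentClass.mk_eq_mk ?_))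
  have key : ∀ {p q : ℕ} (γ : DualBasis C E p) (γ' : DualBasis C E q),
      (Matrix.of fun i k => ((inner C (γ'.y k) (P (γ.x i)) : C) : Unitization ℂ C) :
        Matrix (Fin p) (Fin q) (Unitization ℂ C)) *
      (Matrix.of fun i k => ((inner C (γ.y k) (P (γ'.x i)) : C) : Unitization ℂ C) :
        Matrix (Fin q) (Fin p) (Unitization ℂ C)) = (projectionMatrix γ P hP).mat := by
    intro p q γ γ'
    ext1 i k
    simp only [Matrix.mul_apply, Matrix.of_apply, ← Unitization.inr_mul, projectionMatrix]
    refine (map_sum (Unitization.inrNonUnitalStarAlgHom ℂ C)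
      (fun j => inner C (γ'.y j) (P (γ.x i)) * inner C (γ.y k) (P (γ'.x j)))
      Finset.univ).symm.trans ?_
    rw [γ'.sum_inner_mul_inner P (P (γ.x i)) (γ.y k), hP]
    rfl
  exact ⟨_, _, key β β', key β' β⟩

/-! ### Spectral projections -/

/-- `Q` is the positive projection of the restriction of the self-adjoint operator `D` to the
`D`-invariant closed submodule `W`: a self-adjoint idempotent with range in `W`, commuting with `D`,
such that on `W` the operator `D` is `≥ 0` on the range of `Q` and `≤ 0` on its complement. If `D` is
invertible, there is exactly one such `Q`. -/
structure IsPositiveProjectionOn (D Q : Adjointable C E E) (W : Set E) : Prop where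
  selfAdjoint : Q.adjoint = Q
  idem : ∀ v, Q (Q v) = Q v
  range_subset : ∀ v, Q v ∈ W
  comm : ∀ v, Q (D v) = D (Q v)
  nonneg : ∀ v ∈ W, (0 : C) ≤ inner C (Q v) (D (Q v))
  nonpos : ∀ v ∈ W, inner C (v - Q v) (D (v - Q v)) ≤ (0 : C)

/-- `Q` is the negative projection of the restriction of `D` to `W`. -/
def IsNegativeProjectionOn (D Q : Adjointable C E E) (W : Set E) : Prop :=
  IsPositiveProjectionOn (-D) Q W

/-! ### Hilbert–Poincaré complexes -/

/-- The homology `ker d / im d` of an operator with `d ∘ d = 0`. -/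
abbrev Homology (d : E →ₗ[ℂ] E) : Type _ :=
  LinearMap.ker d ⧸ (LinearMap.range d).submoduleOf (LinearMap.ker d)

/-- `f` maps cycles of `d` to cycles of `d'`, and the assignment `[v] ↦ [f v]` is a well-defined
isomorphism from the homology of `d` to the homology of `d'`. -/
def InducesHomologyIso (d : Adjointable C E E) (d' : Adjointable C F F) (f : Adjointable C E F) :
    Prop :=
  ∃ φ : Homology (d.op : E →ₗ[ℂ] E) ≃ₗ[ℂ] Homology (d'.op : F →ₗ[ℂ] F),
    ∀ (v : E) (hv : v ∈ LinearMap.ker (d.op : E →ₗ[ℂ] E)),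
      ∃ hw : f v ∈ LinearMap.ker (d'.op : F →ₗ[ℂ] F),
        φ (Submodule.Quotient.mk ⟨v, hv⟩) = Submodule.Quotient.mk ⟨f v, hw⟩

variable (C E) in
/-- An orthogonal direct sum decomposition `E = E₀ ⊕ ⋯ ⊕ Eₙ` of Hilbert modules, given by the
orthogonal projections `proj k` onto the summands `E_k`. -/
structure Grading (n : ℕ) where
  proj : ℕ → Adjointable C E E
  selfAdjoint : ∀ k, (proj k).adjoint = proj k
  idem : ∀ k v, proj k (proj k v) = proj k v
  orthogonal : ∀ k l v, k ≠ l → proj k (proj l v) = 0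
  eq_zero_of_lt : ∀ k v, n < k → proj k v = 0
  sum_proj : ∀ v, ∑ k ∈ Finset.range (n + 1), proj k v = v

/-- `(E, b)` is an `n`-dimensional chain complex of finitely generated projective Hilbert modules:
`b` maps `E_{k+1}` to `E_k`, vanishes on `E₀`, and has square zero. -/
structure IsChainComplex {n : ℕ} (g : Grading C E n) (b : Adjointable C E E) : Prop where
  isFGProjective : IsFGProjective C E
  degree_zero : ∀ v, b (g.proj 0 v) = 0
  degree_succ : ∀ k v, b (g.proj (k + 1) v) = g.proj k (b v)
  sq_zero : ∀ v, b (b v) = 0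

/-- `S` maps `E_{n-k}` to `E_k` for `0 ≤ k ≤ n`. -/
def HasDualityDegree {n : ℕ} (g : Grading C E n) (S : Adjointable C E E) : Prop :=
  ∀ k ≤ n, ∀ v, S (g.proj (n - k) v) = g.proj k (S v)

/-- `(E, b, S)` is an `n`-dimensional algebraic Hilbert–Poincaré complex over `C`. -/
structure IsHilbertPoincareComplex {n : ℕ} (g : Grading C E n) (b S : Adjointable C E E) :
    Prop where
  complex : IsChainComplex g b
  selfAdjoint : S.adjoint = S
  degree : HasDualityDegree g S
  chain : ∀ v, b (S v) + S (b.adjoint v) = 0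
  duality : InducesHomologyIso b.adjoint b S

/-- `((E, b, S), (E₀, b₀))` is an `(n+1)`-dimensional algebraic Hilbert–Poincaré complex with
boundary: `i : E₀ → E` is the inclusion of an `n`-dimensional subcomplex, which is an orthogonal
summand `E = E₀ ⊕ E₁`, and `j : E → E₁ = E / E₀` is the quotient map, so that `j b j*` is the
differential induced on the quotient complex. The operator `bS + Sb*` takes values in `E₀`, and `S`
induces an isomorphism from the homology of `(E, b*)` to that of `E / E₀`. -/
structure IsHilbertPoincareComplexWithBoundary {E₀ : Type*} [NormedAddCommGroup E₀]
    [NormedSpace ℂ E₀] [SMul C E₀] [CStarModule C E₀] {E₁ : Type*} [NormedAddCommGroup E₁]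
    [NormedSpace ℂ E₁] [SMul C E₁] [CStarModule C E₁] {n : ℕ}
    (g : Grading C E (n + 1)) (b S : Adjointable C E E)
    (g₀ : Grading C E₀ n) (b₀ : Adjointable C E₀ E₀)
    (i : Adjointable C E₀ E) (j : Adjointable C E E₁) : Prop where
  complex : IsChainComplex g b
  boundary_complex : IsChainComplex g₀ b₀
  isometry : ∀ v, i.adjoint (i v) = v
  coisometry : ∀ v, j (j.adjoint v) = v
  decomposition : ∀ v, i (i.adjoint v) + j.adjoint (j v) = v
  inclusion_degree : ∀ k v, i (g₀.proj k v) = g.proj k (i v)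
  inclusion_chain : ∀ v, i (b₀ v) = b (i v)
  selfAdjoint : S.adjoint = S
  degree : HasDualityDegree g S
  chain : ∀ v, j (b (S v) + S (b.adjoint v)) = 0
  duality : InducesHomologyIso b.adjoint (j.comp (b.comp j.adjoint)) (j.comp S)

/-- The operator `S₀ = (bS + Sb*)|_{E₀}` on `E₀`, where `i : E₀ → E` is the inclusion. -/
def boundaryDuality (b S : Adjointable C E E) (i : Adjointable C F E) : Adjointable C F F :=
  i.adjoint.comp ((b.comp S + S.comp b.adjoint).comp i)

/-! ### Signatures -/

/-- The Higson–Roe signature of `(E, b, S)` is `[P₊] - [P₋]`, with `P₊` and `P₋` the positive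
projections of the (invertible) operators `B + S` and `B - S`, where `B = b + b*`. The predicate
says that this is defined and equal to `σ`. -/
def HasHigsonRoeSignature (b S : Adjointable C E E) (σ : K0 C) : Prop :=
  Function.Bijective (b + b.adjoint + S) ∧ Function.Bijective (b + b.adjoint - S) ∧
  ∃ (m : ℕ) (β : DualBasis C E m) (P Q : Adjointable C E E)
    (hP : IsPositiveProjectionOn (b + b.adjoint + S) P Set.univ)
    (hQ : IsPositiveProjectionOn (b + b.adjoint - S) Q Set.univ),
    σ = projectionClass β P hP.idem - projectionClass β Q hQ.idem

variable [StarOrderedRing C]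

/-- The differential `!![-b', 0; A, b]` of the mapping cone `E' ⊕ E` of `A : (E', b') → (E, b)`. -/
noncomputable def coneDifferential (b' : Adjointable C F F) (b : Adjointable C E E)
    (A : Adjointable C F E) :
    Adjointable C (WithCStarModule C (F × E)) (WithCStarModule C (F × E)) :=
  Adjointable.block (-b') 0 A b

/-- The differential `b_S` of the mapping cone of `S : (E, -b*) → (E, b)`. -/
noncomputable def coneOfDuality (b S : Adjointable C E E) :
    Adjointable C (WithCStarModule C (E × E)) (WithCStarModule C (E × E)) :=
  coneDifferential (-b.adjoint) b S

/-- The operator `B_S = b_S* + b_S` on `E ⊕ E`. -/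
noncomputable def coneOperator (b S : Adjointable C E E) :
    Adjointable C (WithCStarModule C (E × E)) (WithCStarModule C (E × E)) :=
  (coneOfDuality b S).adjoint + coneOfDuality b S

variable (C E) in
/-- The `+1` eigenspace of the symmetry of `E ⊕ E` exchanging the two summands. -/
def symmetricPart : Set (WithCStarModule C (E × E)) :=
  {w | Adjointable.block (0 : Adjointable C E E) (Adjointable.id C E) (Adjointable.id C E) 0 w = w}

/-- The Mishchenko signature of `(E, b, S)` is `[Q₊] - [Q₋]`, with `Q₊` and `Q₋` the positive and
negative projections of the restriction of the (invertible) operator `B_S` to the `+1` eigenspace of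
the symmetry exchanging the two summands of `E ⊕ E`. The predicate says that this is defined and
equal to `σ`. -/
def HasMishchenkoSignature (b S : Adjointable C E E) (σ : K0 C) : Prop :=
  Function.Bijective (coneOperator b S) ∧
  ∃ (m : ℕ) (β : DualBasis C (WithCStarModule C (E × E)) m)
    (P Q : Adjointable C (WithCStarModule C (E × E)) (WithCStarModule C (E × E)))
    (hP : IsPositiveProjectionOn (coneOperator b S) P (symmetricPart C E))
    (hQ : IsNegativeProjectionOn (coneOperator b S) Q (symmetricPart C E)),
    σ = projectionClass β P hP.idem - projectionClass β Q hQ.idem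

end Modules
end HilbertPoincare

/-! Up to homotopy, the boundary duality is transported from a hyperbolic form, and hyperbolic forms
have signature zero.

Put `b₁ = j b j*` on the quotient `E₁`. On `F = E₁ ⊕ E₁` take the differential `d` with rows `(b₁, j
S j*)` and `(0, b₁*)`, the swap `σ` of the summands, and the map `f : F → E₀`, `f (x, y) = i* b j* x
+ i* S j* y`. After multiplying `d` by `-√-1` and `b₀` by `√-1`, `f` is a chain map. It is a
homology isomorphism (`isQuasiIso_coneToBoundary`) because the adjoint `S j* : (E₁, b₁*) → (E, b)`
of the given duality is one. Inserting `1 = i i* + j* j` into the definition of `S₀` gives `S₀ = f σ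
f* + b₀ h + h b₀*` with `h = i* S i` (`boundaryDuality_eq`). Hence `S₀` is a duality.

The comparison of classes uses a rotation: on `E₀ ⊕ F` the operators `cos t (S₀ ⊕ -σ) + sin t (f σ,
σ f*)`, with the second term off-diagonal, join `S₀ ⊕ -σ` to `-S₀ ⊕ σ`. On homology they act, after
identification by `f`, as `σ` times the involution with rows `(cos t, sin t)` and `(sin t, -cos t)`,
so all of them are dualities (`isQuasiIso_rotation`). A duality makes the signature operator
invertible: its mapping cone is acyclic, and an acyclic differential `D` has `D + D*` invertible
(`isUnit_of_isExact`). The class of the positive eigenspace is constant along paths of invertible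
self-adjoint operators (`IsSign.signClass_eq_of_homotopy`). This equates two sums of classes. The
terms from `F` agree: `σ` is an involution, so the differential can be scaled to zero
(`signClass_eq_of_involution`), and `diag(1, -1)` conjugates `σ` to `-σ` (`signClass_swap`).
Cancelling them in `K₀` shows that `b + b* + S₀` and `b + b* - S₀`, with `b = √-1 b₀`, have positive
eigenspaces of the same class.

This is the Higson–Roe statement. On the diagonal of `E₀ ⊕ E₀` the operator `B_S` is `b + b* + S₀`,
so Mishchenko's signature compares its positive and negative eigenspaces; conjugation by the grading
sign `(-1)ᵏ` reduces this to the previous equality for `n` even, and proves it outright for `n` odd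
(`signClass_eq_neg`). -/

namespace HilbertPoincare

set_option linter.unusedSectionVars false

/-! ### The C⋆-algebra of adjointable operators -/

namespace Adjointable

section Basic

variable {C : Type*} [NonUnitalCStarAlgebra C] [PartialOrder C]
  {E : Type*} [NormedAddCommGroup E] [NormedSpace ℂ E] [SMul C E] [CStarModule C E]
  {F : Type*} [NormedAddCommGroup F] [NormedSpace ℂ F] [SMul C F] [CStarModule C F]
  {G : Type*} [NormedAddCommGroup G] [NormedSpace ℂ G] [SMul C G] [CStarModule C G]

variable (C) in
theorem eq_of_inner_right {x y : E} (h : ∀ w : E, inner C w x = inner C w y) : x = y := by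
  have h0 : inner C (x - y) (x - y) = 0 := by
    rw [CStarModule.inner_sub_right, h, sub_self]
  exact sub_eq_zero.mp (CStarModule.inner_self.mp h0)

theorem inner_adjoint (T : Adjointable C E F) (x : F) (y : E) :
    inner C (T.adjoint x) y = inner C x (T y) := T.adjoint.inner_op x y

theorem inner_adjoint_right (T : Adjointable C E F) (x : E) (y : F) :
    inner C x (T.adjoint y) = inner C (T x) y := (T.inner_op x y).symm

/-- Nondegeneracy of the inner product determines the adjoint, so identities between adjointable
operators may be checked on vectors. -/
theorem op_injective : Function.Injective (Adjointable.op : Adjointable C E F → E →L[ℂ] F) := by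
  intro T U h
  refine Adjointable.ext h ?_
  ext y
  refine eq_of_inner_right C fun w => ?_
  rw [← T.inner_op, ← U.inner_op, h]

theorem ext_apply {T U : Adjointable C E F} (h : ∀ x, T x = U x) : T = U :=
  op_injective (ContinuousLinearMap.ext h)

@[simp] protected theorem zero_apply (x : E) : (0 : Adjointable C E F) x = 0 := rfl
@[simp] protected theorem add_apply (T U : Adjointable C E F) (x : E) : (T + U) x = T x + U x := rfl
@[simp] protected theorem neg_apply (T : Adjointable C E F) (x : E) : (-T) x = -T x := rfl
@[simp] protected theorem sub_apply (T U : Adjointable C E F) (x : E) : (T - U) x = T x - U x := rfl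
@[simp] protected theorem smul_apply (z : ℂ) (T : Adjointable C E F) (x : E) : (z • T) x = z • T x := rfl
@[simp] protected theorem comp_apply (T : Adjointable C F G) (U : Adjointable C E F) (x : E) :
    (T.comp U) x = T (U x) := rfl
@[simp] protected theorem id_apply (x : E) : (Adjointable.id C E) x = x := rfl

@[simp] theorem adjoint_adjoint (T : Adjointable C E F) : T.adjoint.adjoint = T := rfl
@[simp] theorem adjoint_zero : (0 : Adjointable C E F).adjoint = 0 := rfl
@[simp] theorem adjoint_add (T U : Adjointable C E F) :
    (T + U).adjoint = T.adjoint + U.adjoint := rfl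
@[simp] theorem adjoint_neg (T : Adjointable C E F) : (-T).adjoint = -T.adjoint := rfl
@[simp] theorem adjoint_sub (T U : Adjointable C E F) :
    (T - U).adjoint = T.adjoint - U.adjoint := rfl
@[simp] theorem adjoint_smul (z : ℂ) (T : Adjointable C E F) :
    (z • T).adjoint = star z • T.adjoint := op_injective rfl
@[simp] theorem adjoint_comp (T : Adjointable C F G) (U : Adjointable C E F) :
    (T.comp U).adjoint = U.adjoint.comp T.adjoint := rfl

instance instMul : Mul (Adjointable C E E) := ⟨Adjointable.comp⟩
instance instOne : One (Adjointable C E E) := ⟨Adjointable.id C E⟩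

@[simp] protected theorem mul_apply (T U : Adjointable C E E) (x : E) : (T * U) x = T (U x) := rfl
@[simp] protected theorem one_apply (x : E) : (1 : Adjointable C E E) x = x := rfl

instance instRing : Ring (Adjointable C E E) where
  add_assoc _ _ _ := ext_apply fun _ => add_assoc _ _ _
  zero_add _ := ext_apply fun _ => zero_add _
  add_zero _ := ext_apply fun _ => add_zero _
  add_comm _ _ := ext_apply fun _ => add_comm _ _
  nsmul := nsmulRec
  zsmul := zsmulRec
  sub_eq_add_neg _ _ := ext_apply fun _ => sub_eq_add_neg _ _
  neg_add_cancel _ := ext_apply fun _ => neg_add_cancel _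
  mul_assoc _ _ _ := ext_apply fun _ => rfl
  one_mul _ := ext_apply fun _ => rfl
  mul_one _ := ext_apply fun _ => rfl
  zero_mul _ := ext_apply fun _ => rfl
  mul_zero T := ext_apply fun _ => map_zero T.op
  left_distrib T U V := ext_apply fun x => map_add T.op (U x) (V x)
  right_distrib _ _ _ := ext_apply fun _ => rfl

instance instAlgebra : Algebra ℂ (Adjointable C E E) where
  algebraMap :=
    { toFun := fun z => z • 1
      map_one' := ext_apply fun _ => one_smul ℂ _
      map_mul' := fun z w => ext_apply fun x => mul_smul z w x
      map_zero' := ext_apply fun x => zero_smul ℂ x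
      map_add' := fun z w => ext_apply fun x => add_smul z w x }
  commutes' z T := ext_apply fun x => (map_smul T.op z x).symm
  smul_def' _ _ := ext_apply fun _ => rfl

instance instStarRing : StarRing (Adjointable C E E) where
  star := adjoint
  star_involutive _ := rfl
  star_mul _ _ := rfl
  star_add _ _ := rfl

theorem star_eq_adjoint (T : Adjointable C E E) : star T = T.adjoint := rfl

instance instStarModule : StarModule ℂ (Adjointable C E E) := ⟨adjoint_smul⟩

/-- The operator underlying an adjointable operator, as a homomorphism of algebras. -/
def opHom : Adjointable C E E →+* (E →L[ℂ] E) where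
  toFun := Adjointable.op
  map_one' := rfl
  map_mul' _ _ := rfl
  map_zero' := rfl
  map_add' _ _ := rfl

noncomputable instance instNormedRing : NormedRing (Adjointable C E E) :=
  NormedRing.induced (Adjointable C E E) (E →L[ℂ] E) opHom op_injective

theorem norm_def (T : Adjointable C E E) : ‖T‖ = ‖T.op‖ := rfl

theorem le_norm (T : Adjointable C E E) (x : E) : ‖T x‖ ≤ ‖T‖ * ‖x‖ := T.op.le_opNorm x

noncomputable instance instNormedAlgebra : NormedAlgebra ℂ (Adjointable C E E) where
  norm_smul_le z T := norm_smul_le z T.op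

theorem exists_bound_of_isUnit {D : Adjointable C E E} (hD : IsUnit D) :
    ∃ K : ℝ, 0 < K ∧ ∀ v, ‖v‖ ≤ K * ‖D v‖ := by
  obtain ⟨U, rfl⟩ := hD
  refine ⟨‖((U⁻¹ : (Adjointable C E E)ˣ) : Adjointable C E E)‖ + 1, by positivity, fun v => ?_⟩
  have e : ((U⁻¹ : (Adjointable C E E)ˣ) : Adjointable C E E) ((U : Adjointable C E E) v) = v := by
    rw [← Adjointable.mul_apply, Units.inv_mul, Adjointable.one_apply]
  calc ‖v‖ = _ := by rw [e]
    _ ≤ _ := le_norm _ _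
    _ ≤ _ := by gcongr; linarith

theorem bijective_of_isUnit {D : Adjointable C E E} (hD : IsUnit D) : Function.Bijective D := by
  obtain ⟨U, rfl⟩ := hD
  refine Function.bijective_iff_has_inverse.mpr
    ⟨((U⁻¹ : (Adjointable C E E)ˣ) : Adjointable C E E), fun v => ?_, fun v => ?_⟩
  · rw [← Adjointable.mul_apply, Units.inv_mul, Adjointable.one_apply]
  · rw [← Adjointable.mul_apply, Units.mul_inv, Adjointable.one_apply]

end Basic

/-! ### C⋆-identity, completeness, and invertibility from lower bounds -/

section CStar

variable {C : Type*} [NonUnitalCStarAlgebra C] [PartialOrder C] [StarOrderedRing C]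
  {E : Type*} [NormedAddCommGroup E] [NormedSpace ℂ E] [SMul C E] [CStarModule C E]

theorem norm_op_le_norm_adj (T : Adjointable C E E) : ‖T.op‖ ≤ ‖T.adj‖ := by
  refine ContinuousLinearMap.opNorm_le_bound _ (norm_nonneg _) fun x => ?_
  have h : ‖T x‖ ^ 2 ≤ ‖x‖ * (‖T.adj‖ * ‖T x‖) := by
    rw [CStarModule.norm_sq_eq C, T.inner_op]
    exact (CStarModule.norm_inner_le E).trans (by gcongr; exact T.adj.le_opNorm _)
  rcases (norm_nonneg (T x)).eq_or_lt with h0 | h0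
  · change ‖T x‖ ≤ _
    rw [← h0]; positivity
  · change ‖T x‖ ≤ _
    nlinarith

theorem norm_adjoint (T : Adjointable C E E) : ‖T.adj‖ = ‖T.op‖ :=
  le_antisymm (norm_op_le_norm_adj T.adjoint) (norm_op_le_norm_adj T)

instance instCStarRing : CStarRing (Adjointable C E E) where
  norm_mul_self_le T := by
    have h : ‖T.op‖ ≤ Real.sqrt ‖star T * T‖ := by
      refine ContinuousLinearMap.opNorm_le_bound _ (Real.sqrt_nonneg _) fun x => ?_
      refine abs_le_of_sq_le_sq' ?_ (by positivity) |>.2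
      rw [mul_pow, Real.sq_sqrt (norm_nonneg _)]
      change ‖T x‖ ^ 2 ≤ _
      rw [CStarModule.norm_sq_eq C, T.inner_op]
      refine (CStarModule.norm_inner_le E).trans ?_
      have := le_norm (star T * T) x
      calc ‖x‖ * ‖(star T * T) x‖ ≤ ‖x‖ * (‖star T * T‖ * ‖x‖) := by gcongr
        _ = _ := by ring
    calc ‖T‖ * ‖T‖ ≤ Real.sqrt ‖star T * T‖ * Real.sqrt ‖star T * T‖ :=
          mul_le_mul h h (norm_nonneg _) (Real.sqrt_nonneg _)
      _ = _ := Real.mul_self_sqrt (norm_nonneg _)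

instance instCompleteSpace [CompleteSpace E] : CompleteSpace (Adjointable C E E) := by
  refine Metric.complete_of_cauchySeq_tendsto fun u hu => ?_
  have h1 : CauchySeq fun n => (u n).op := by
    rw [Metric.cauchySeq_iff] at hu ⊢
    exact hu
  -- Taking adjoints is isometric, so the adjoints converge too and their limit is the adjoint of
  -- the limit.
  have h2 : CauchySeq fun n => (u n).adj := by
    rw [Metric.cauchySeq_iff] at hu ⊢
    intro ε hε
    obtain ⟨N, hN⟩ := hu ε hε
    refine ⟨N, fun m hm n hn => ?_⟩
    have := hN m hm n hn
    rw [dist_eq_norm] at this ⊢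
    rwa [norm_def, ← norm_adjoint] at this
  obtain ⟨A, hA⟩ := cauchySeq_tendsto_of_complete h1
  obtain ⟨B, hB⟩ := cauchySeq_tendsto_of_complete h2
  refine ⟨⟨A, B, fun x y => ?_⟩, ?_⟩
  · have hAx : Filter.Tendsto (fun n => (u n).op x) Filter.atTop (nhds (A x)) :=
      ((ContinuousLinearMap.apply ℂ E x).continuous.tendsto A).comp hA
    have hBy : Filter.Tendsto (fun n => (u n).adj y) Filter.atTop (nhds (B y)) :=
      ((ContinuousLinearMap.apply ℂ E y).continuous.tendsto B).comp hB
    have hc := CStarModule.continuous_inner (A := C) (E := E)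
    have e1 := (hc.tendsto (A x, y)).comp (hAx.prodMk_nhds tendsto_const_nhds)
    have e2 := (hc.tendsto (x, B y)).comp ((tendsto_const_nhds (x := x)).prodMk_nhds hBy)
    refine tendsto_nhds_unique e1 (e2.congr fun n => ?_)
    exact ((u n).inner_op x y).symm
  · rw [tendsto_iff_norm_sub_tendsto_zero] at hA ⊢
    exact hA

noncomputable instance instCStarAlgebra [CompleteSpace E] : CStarAlgebra (Adjointable C E E) where

/-- A self-adjoint operator that is bounded below is invertible. -/
theorem isUnit_of_bounded_below [CompleteSpace E] {D : Adjointable C E E} (hD : star D = D) {K : ℝ}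
    (h : ∀ v, ‖v‖ ≤ K * ‖D v‖) : IsUnit D := by
  set K' : ℝ := max K 1 with hK'
  have hK0 : 0 < K' := lt_of_lt_of_le one_pos (le_max_right _ _)
  have h' : ∀ v, ‖v‖ ≤ K' * ‖D v‖ := fun v =>
    (h v).trans (by gcongr; exact le_max_left _ _)
  -- The spectrum of `D` is real, so `z - D` is invertible for `z = t √-1`. The lower bound for `D`
  -- with `K' t = 1/4` bounds the inverse by `2 K'`, uniformly enough that `‖z (z - D)⁻¹‖ ≤ 1/2`; a
  -- Neumann series then removes the shift by `z`.
  set t : ℝ := 1 / (4 * K') with ht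
  have ht0 : 0 < t := by positivity
  set z : ℂ := (t : ℂ) * Complex.I with hz
  have hzn : ‖z‖ = t := by simp [hz, abs_of_pos ht0]
  have hnot : z ∉ spectrum ℂ D := by
    intro hmem
    have := IsSelfAdjoint.mem_spectrum_eq_re (a := D) hD hmem
    have him := congrArg Complex.im this
    simp [hz] at him
    exact ht0.ne' him
  rw [spectrum.notMem_iff] at hnot
  obtain ⟨U, hU⟩ := hnot
  have hUv : ∀ v, ‖((U⁻¹ : (Adjointable C E E)ˣ) : Adjointable C E E) v‖ ≤ (2 * K') * ‖v‖ := by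
    intro v
    set w := ((U⁻¹ : (Adjointable C E E)ˣ) : Adjointable C E E) v with hw
    have e1 : (U : Adjointable C E E) w = v := by
      rw [hw, ← Adjointable.mul_apply, Units.mul_inv, Adjointable.one_apply]
    have e2 : D w = z • w - v := by
      rw [← e1, hU, Algebra.algebraMap_eq_smul_one]
      simp
    have e3 : ‖D w‖ ≤ t * ‖w‖ + ‖v‖ := by
      rw [e2]; exact (norm_sub_le _ _).trans (by rw [norm_smul, hzn])
    have e4 := (h' w).trans (mul_le_mul_of_nonneg_left e3 hK0.le)
    have e5 : K' * t = 1 / 4 := by rw [ht]; field_simp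
    have : ‖w‖ ≤ 1 / 4 * ‖w‖ + K' * ‖v‖ := by
      calc ‖w‖ ≤ K' * (t * ‖w‖ + ‖v‖) := e4
        _ = K' * t * ‖w‖ + K' * ‖v‖ := by ring
        _ = _ := by rw [e5]
    nlinarith [norm_nonneg v, norm_nonneg w]
  have hUn : ‖((U⁻¹ : (Adjointable C E E)ˣ) : Adjointable C E E)‖ ≤ 2 * K' :=
    ContinuousLinearMap.opNorm_le_bound _ (by positivity) hUv
  have hsmall : ‖z • ((U⁻¹ : (Adjointable C E E)ˣ) : Adjointable C E E)‖ < 1 := by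
    rw [norm_smul, hzn]
    calc t * _ ≤ t * (2 * K') := by gcongr
      _ = 1 / 2 := by rw [ht]; field_simp; norm_num
      _ < 1 := by norm_num
  have hDe : D = -((U : Adjointable C E E) *
      (Units.oneSub (z • ((U⁻¹ : (Adjointable C E E)ˣ) : Adjointable C E E)) hsmall :
        (Adjointable C E E)ˣ)) := by
    rw [Units.val_oneSub, mul_sub, mul_one, mul_smul_comm, Units.mul_inv, hU,
      Algebra.algebraMap_eq_smul_one]
    abel
  rw [hDe]
  exact (U.isUnit.mul (Units.isUnit _)).neg

end CStar

end Adjointable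

/-! ### Direct sums -/

section DirectSum

variable {C : Type*} [NonUnitalCStarAlgebra C] [PartialOrder C] [StarOrderedRing C]
  {E : Type*} [NormedAddCommGroup E] [NormedSpace ℂ E] [SMul C E] [CStarModule C E]
  {F : Type*} [NormedAddCommGroup F] [NormedSpace ℂ F] [SMul C F] [CStarModule C F]

namespace Adjointable

variable (C) in
/-- The element `(x, y)` of `E ⊕ F`. -/
noncomputable def pair (x : E) (y : F) : WithCStarModule C (E × F) := ofProd C E F (x, y)

@[simp] theorem pair_fst (x : E) (y : F) : (pair C x y).1 = x := rfl
@[simp] theorem pair_snd (x : E) (y : F) : (pair C x y).2 = y := rfl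

theorem directSum_ext {v w : WithCStarModule C (E × F)} (h1 : v.1 = w.1) (h2 : v.2 = w.2) :
    v = w := Prod.ext h1 h2

@[simp] theorem directSum_add_fst (v w : WithCStarModule C (E × F)) : (v + w).1 = v.1 + w.1 := rfl
@[simp] theorem directSum_add_snd (v w : WithCStarModule C (E × F)) : (v + w).2 = v.2 + w.2 := rfl
@[simp] theorem directSum_neg_fst (v : WithCStarModule C (E × F)) : (-v).1 = -v.1 := rfl
@[simp] theorem directSum_neg_snd (v : WithCStarModule C (E × F)) : (-v).2 = -v.2 := rfl
@[simp] theorem directSum_zero_fst : (0 : WithCStarModule C (E × F)).1 = 0 := rfl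
@[simp] theorem directSum_zero_snd : (0 : WithCStarModule C (E × F)).2 = 0 := rfl

attribute [simp] block_fst block_snd

@[simp] theorem block_adjoint (a : Adjointable C E E) (b : Adjointable C F E)
    (c : Adjointable C E F) (d : Adjointable C F F) :
    (block a b c d).adjoint = block a.adjoint c.adjoint b.adjoint d.adjoint := rfl

variable (C E F) in
/-- The inclusion of the first summand. -/
noncomputable def inl : Adjointable C E (WithCStarModule C (E × F)) where
  op := (ofProd C E F).comp (.inl ℂ E F)
  adj := (ContinuousLinearMap.fst ℂ E F).comp (toProd C E F)
  inner_op x y := by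
    rw [WithCStarModule.prod_inner]
    change inner C x y.1 + inner C (0 : F) y.2 = inner C x y.1
    simp

variable (C E F) in
/-- The inclusion of the second summand. -/
noncomputable def inr : Adjointable C F (WithCStarModule C (E × F)) where
  op := (ofProd C E F).comp (.inr ℂ E F)
  adj := (ContinuousLinearMap.snd ℂ E F).comp (toProd C E F)
  inner_op x y := by
    rw [WithCStarModule.prod_inner]
    change inner C (0 : E) y.1 + inner C x y.2 = inner C x y.2
    simp

@[simp] theorem inl_fst (x : E) : (inl C E F x).1 = x := rfl
@[simp] theorem inl_snd (x : E) : (inl C E F x).2 = 0 := rfl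
@[simp] theorem inr_fst (y : F) : (inr C E F y).1 = 0 := rfl
@[simp] theorem inr_snd (y : F) : (inr C E F y).2 = y := rfl
@[simp] theorem inl_adjoint_apply (v : WithCStarModule C (E × F)) :
    (inl C E F).adjoint v = v.1 := rfl
@[simp] theorem inr_adjoint_apply (v : WithCStarModule C (E × F)) :
    (inr C E F).adjoint v = v.2 := rfl

theorem norm_fst_le (v : WithCStarModule C (E × F)) : ‖v.1‖ ≤ ‖v‖ :=
  (le_max_left _ _).trans (WithCStarModule.max_le_prod_norm v)

end Adjointable

end DirectSum

/-! ### Exactness and homology isomorphisms -/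

open Adjointable

section Exactness

variable {C : Type*} [NonUnitalCStarAlgebra C] [PartialOrder C]
  {E : Type*} [NormedAddCommGroup E] [NormedSpace ℂ E] [SMul C E] [CStarModule C E]
  {F : Type*} [NormedAddCommGroup F] [NormedSpace ℂ F] [SMul C F] [CStarModule C F]

/-- Every cycle of `d` is a boundary. -/
def IsExact (d : Adjointable C E E) : Prop := ∀ x, d x = 0 → ∃ y, x = d y

/-- `A` induces a bijection on homology, stated in terms of cycles and boundaries. -/
structure IsQuasiIso (d : Adjointable C E E) (d' : Adjointable C F F) (A : Adjointable C E F) :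
    Prop where
  inj : ∀ x y, d x = 0 → A x = d' y → ∃ z, x = d z
  surj : ∀ y, d' y = 0 → ∃ x z, d x = 0 ∧ y = A x + d' z

/-- Nonzero scalars change neither cycles nor boundaries. This absorbs the factors `±√-1` and the
signs in the definition of the cone. -/
theorem IsQuasiIso.smul {d : Adjointable C E E} {d' : Adjointable C F F} {A : Adjointable C E F}
    (h : IsQuasiIso d d' A) {z w : ℂ} (hz : z ≠ 0) (hw : w ≠ 0) :
    IsQuasiIso (z • d) (w • d') A where
  inj x y hx hy := by
    rw [Adjointable.smul_apply, smul_eq_zero_iff_right hz] at hx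
    obtain ⟨u, rfl⟩ := h.inj x (w • y) hx (by rw [hy, Adjointable.smul_apply, map_smul])
    exact ⟨z⁻¹ • u, by rw [Adjointable.smul_apply, map_smul, smul_inv_smul₀ hz]⟩
  surj y hy := by
    rw [Adjointable.smul_apply, smul_eq_zero_iff_right hw] at hy
    obtain ⟨x, u, hx, rfl⟩ := h.surj y hy
    exact ⟨x, w⁻¹ • u, by rw [Adjointable.smul_apply, hx, smul_zero],
      by rw [Adjointable.smul_apply, map_smul, smul_inv_smul₀ hw]⟩

theorem IsQuasiIso.neg_left {d : Adjointable C E E} {d' : Adjointable C F F}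
    {A : Adjointable C E F} (h : IsQuasiIso d d' A) : IsQuasiIso (-d) d' A := by
  have := h.smul (z := -1) (w := 1) (by norm_num) one_ne_zero
  rwa [show (-1 : ℂ) • d = -d from ext_apply fun x => by simp,
    show (1 : ℂ) • d' = d' from ext_apply fun x => by simp] at this

theorem InducesHomologyIso.isQuasiIso {d : Adjointable C E E} {d' : Adjointable C F F}
    {A : Adjointable C E F} (h : InducesHomologyIso d d' A) : IsQuasiIso d d' A := by
  obtain ⟨φ, hφ⟩ := h
  refine ⟨fun x y hx hy => ?_, fun y hy => ?_⟩
  · obtain ⟨hw, e⟩ := hφ x hx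
    have h0 : φ (Submodule.Quotient.mk ⟨x, hx⟩) = 0 := by
      rw [e, Submodule.Quotient.mk_eq_zero]
      exact ⟨y, hy.symm⟩
    rw [LinearEquiv.map_eq_zero_iff, Submodule.Quotient.mk_eq_zero] at h0
    obtain ⟨z, hz⟩ := h0
    exact ⟨z, hz.symm⟩
  · obtain ⟨q, hq⟩ := φ.surjective (Submodule.Quotient.mk ⟨y, hy⟩)
    obtain ⟨⟨x, hx⟩, rfl⟩ := Submodule.Quotient.mk_surjective _ q
    obtain ⟨hw, e⟩ := hφ x hx
    rw [e, eq_comm, Submodule.Quotient.eq] at hq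
    obtain ⟨z, hz⟩ := hq
    refine ⟨x, z, hx, ?_⟩
    have hz' : d' z = y - A x := hz
    rw [hz', add_sub_cancel]

/-- The auxiliary `A'` allows maps that commute with the differentials only up to sign; for a
duality it is `-A`. -/
theorem IsQuasiIso.inducesHomologyIso {d : Adjointable C E E} {d' : Adjointable C F F}
    {A : Adjointable C E F} (h : IsQuasiIso d d' A) {A' : Adjointable C E F}
    (hA : ∀ x, d' (A x) = A' (d x)) (hA' : ∀ x, A (d x) = d' (A' x)) :
    InducesHomologyIso d d' A := by
  have hker : ∀ v ∈ LinearMap.ker (d.op : E →ₗ[ℂ] E),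
      (A.op : E →ₗ[ℂ] F) v ∈ LinearMap.ker (d'.op : F →ₗ[ℂ] F) := by
    intro v hv
    have hv' : d v = 0 := hv
    change d' (A v) = 0
    rw [hA, hv', map_zero]
  let g := (A.op : E →ₗ[ℂ] F).restrict hker
  have hle : (LinearMap.range (d.op : E →ₗ[ℂ] E)).submoduleOf (LinearMap.ker (d.op : E →ₗ[ℂ] E)) ≤
      ((LinearMap.range (d'.op : F →ₗ[ℂ] F)).submoduleOf
        (LinearMap.ker (d'.op : F →ₗ[ℂ] F))).comap g := by
    rintro ⟨v, hv⟩ ⟨z, rfl⟩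
    exact ⟨A' z, (hA' z).symm⟩
  have hbij : Function.Bijective (Submodule.mapQ _ _ g hle) := by
    constructor
    · rw [← LinearMap.ker_eq_bot, LinearMap.ker_eq_bot']
      intro q hq
      obtain ⟨⟨x, hx⟩, rfl⟩ := Submodule.Quotient.mk_surjective _ q
      rw [Submodule.mapQ_apply, Submodule.Quotient.mk_eq_zero] at hq
      obtain ⟨y, hy⟩ := hq
      obtain ⟨z, hz⟩ := h.inj x y hx hy.symm
      rw [Submodule.Quotient.mk_eq_zero]
      exact ⟨z, hz.symm⟩
    · intro q
      obtain ⟨⟨y, hy⟩, rfl⟩ := Submodule.Quotient.mk_surjective _ q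
      obtain ⟨x, z, hx, e⟩ := h.surj y hy
      refine ⟨Submodule.Quotient.mk ⟨x, hx⟩, ?_⟩
      rw [Submodule.mapQ_apply, eq_comm, Submodule.Quotient.eq]
      refine ⟨z, ?_⟩
      change d' z = y - A x
      rw [e, add_sub_cancel_left]
  refine ⟨LinearEquiv.ofBijective _ hbij, fun v hv => ⟨hker v hv, ?_⟩⟩
  rfl

/-! ### Acyclicity, mapping cones and invertibility -/

variable [StarOrderedRing C]

/-- The open mapping theorem for `d : E → ker d` gives lifts of controlled norm, and these replace
orthogonal complements, which Hilbert modules need not have. Writing `v = y + (v - y)` with `y` a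
short lift of `d v`, the cycle `v - y = d w` is controlled by `d* (v - y)` through `⟨d w, v - y⟩ =
⟨w, d* (v - y)⟩`. So `d* + d` is bounded below. -/
theorem isUnit_of_isExact [CompleteSpace E] {d : Adjointable C E E} (hd : ∀ v, d (d v) = 0)
    (h : IsExact d) : IsUnit (d.adjoint + d) := by
  let Z := LinearMap.ker (d.op : E →ₗ[ℂ] E)
  have hZ : IsClosed (Z : Set E) := d.op.isClosed_ker
  have : CompleteSpace Z := hZ.completeSpace_coe
  let p : E →L[ℂ] Z := d.op.codRestrict Z fun x => hd x
  have hp : Function.Surjective p := by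
    rintro ⟨z, hz⟩
    obtain ⟨y, hy⟩ := h z hz
    exact ⟨y, Subtype.ext hy.symm⟩
  obtain ⟨K, hK0, hK⟩ := p.exists_preimage_norm_le hp
  have hK : ∀ z, d z = 0 → ∃ y, d y = z ∧ ‖y‖ ≤ K * ‖z‖ := fun z hz => by
    obtain ⟨y, hy, hy'⟩ := hK ⟨z, hz⟩
    exact ⟨y, congrArg Subtype.val hy, hy'⟩
  -- The ranges of `d` and `d*` are orthogonal since `d² = 0`; hence `d v` and `d* v` are both
  -- dominated by `(d* + d) v`.
  have hinner : ∀ v, inner C ((d.adjoint + d) v) ((d.adjoint + d) v) =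
      inner C (d.adjoint v) (d.adjoint v) + inner C (d v) (d v) := by
    intro v
    have e1 : inner C (d.adjoint v) (d v) = 0 := by
      rw [inner_adjoint, hd, CStarModule.inner_zero_right]
    have e2 : inner C (d v) (d.adjoint v) = 0 := by
      rw [← CStarModule.star_inner, e1, star_zero]
    rw [Adjointable.add_apply, CStarModule.inner_add_left, CStarModule.inner_add_right,
      CStarModule.inner_add_right, e1, e2, add_zero, zero_add]
  have hd1 : ∀ v, ‖d v‖ ≤ ‖(d.adjoint + d) v‖ := fun v => by
    refine abs_le_of_sq_le_sq' ?_ (norm_nonneg _) |>.2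
    rw [CStarModule.norm_sq_eq C, CStarModule.norm_sq_eq C, hinner]
    exact CStarAlgebra.norm_le_norm_of_nonneg_of_le CStarModule.inner_self_nonneg
      (le_add_of_nonneg_left CStarModule.inner_self_nonneg)
  have hd2 : ∀ v, ‖d.adjoint v‖ ≤ ‖(d.adjoint + d) v‖ := fun v => by
    refine abs_le_of_sq_le_sq' ?_ (norm_nonneg _) |>.2
    rw [CStarModule.norm_sq_eq C, CStarModule.norm_sq_eq C, hinner]
    exact CStarAlgebra.norm_le_norm_of_nonneg_of_le CStarModule.inner_self_nonneg
      (le_add_of_nonneg_right CStarModule.inner_self_nonneg)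
  refine isUnit_of_bounded_below (K := K + K * (1 + ‖d.adj‖ * K)) ?_ fun v => ?_
  · rw [star_eq_adjoint, adjoint_add, adjoint_adjoint, add_comm]
  set r := ‖(d.adjoint + d) v‖
  obtain ⟨y, hy, hyn⟩ := hK (d v) (hd v)
  obtain ⟨w, hw, hwn⟩ := hK (v - y) (by rw [map_sub, hy, sub_self])
  have h1 : ‖y‖ ≤ K * r := hyn.trans (by gcongr; exact hd1 v)
  have h2 : ‖d.adjoint (v - y)‖ ≤ (1 + ‖d.adj‖ * K) * r := by
    rw [map_sub]
    calc _ ≤ ‖d.adjoint v‖ + ‖d.adjoint y‖ := norm_sub_le _ _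
      _ ≤ r + ‖d.adj‖ * (K * r) := by
        gcongr
        · exact hd2 v
        · exact (d.adj.le_opNorm y).trans (by gcongr)
      _ = _ := by ring
  have h3 : ‖v - y‖ ^ 2 ≤ ‖d.adjoint (v - y)‖ * (K * ‖v - y‖) := by
    rw [CStarModule.norm_sq_eq C]
    conv_lhs => rw [← hw, d.inner_op, hw, ← CStarModule.star_inner, norm_star]
    exact (CStarModule.norm_inner_le E).trans (by gcongr; rfl)
  have h4 : ‖v - y‖ ≤ K * ((1 + ‖d.adj‖ * K) * r) := by
    rcases (norm_nonneg (v - y)).eq_or_lt with h0 | h0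
    · rw [← h0]; positivity
    · have : ‖v - y‖ ≤ ‖d.adjoint (v - y)‖ * K := by nlinarith
      calc _ ≤ _ := this
        _ ≤ ((1 + ‖d.adj‖ * K) * r) * K := by gcongr
        _ = _ := by ring
  calc ‖v‖ = ‖y + (v - y)‖ := by rw [add_sub_cancel]
    _ ≤ ‖y‖ + ‖v - y‖ := norm_add_le _ _
    _ ≤ K * r + K * ((1 + ‖d.adj‖ * K) * r) := add_le_add h1 h4
    _ = _ := by ring

theorem adjoint_sq_zero {d : Adjointable C E E} (hd : ∀ v, d (d v) = 0) (v : E) :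
    d.adjoint (d.adjoint v) = 0 := eq_of_inner_right C fun w => by
  rw [inner_adjoint_right, inner_adjoint_right, hd, CStarModule.inner_zero_left,
    CStarModule.inner_zero_right]

/-- Every `x` is `(d* + d)² z = d* d z + d d* z`. If `d x = 0`, then `d d* (d z) = 0`, so pairing
with `d z` shows `d* d z = 0` and `x = d (d* z)`. -/
theorem isExact_of_isUnit {d : Adjointable C E E} (hd : ∀ v, d (d v) = 0)
    (h : IsUnit (d.adjoint + d)) : IsExact d := by
  intro x hx
  obtain ⟨y, hy⟩ := (bijective_of_isUnit h).surjective x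
  obtain ⟨z, rfl⟩ := (bijective_of_isUnit h).surjective y
  have hd' := adjoint_sq_zero hd z
  have e : x = d.adjoint (d z) + d (d.adjoint z) := by
    rw [← hy]
    simp [hd, hd']
  have e1 : d (d.adjoint (d z)) = 0 := by
    rw [e, map_add, hd, add_zero] at hx
    exact hx
  have e2 : d.adjoint (d z) = 0 := by
    refine (CStarModule.inner_self (A := C)).mp ?_
    rw [inner_adjoint, e1, CStarModule.inner_zero_right]
  exact ⟨d.adjoint z, by rw [e, e2, zero_add]⟩

/-- Exactness is equivalent to invertibility of `d* + d`, a condition symmetric in `d` and `d*`. -/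
theorem isExact_adjoint [CompleteSpace E] {d : Adjointable C E E} (hd : ∀ v, d (d v) = 0)
    (h : IsExact d) : IsExact d.adjoint := by
  refine isExact_of_isUnit (adjoint_sq_zero hd) ?_
  rw [adjoint_adjoint, add_comm]
  exact isUnit_of_isExact hd h

theorem coneDifferential_sq_zero {d : Adjointable C E E} {d' : Adjointable C F F}
    {A : Adjointable C E F} (hd : ∀ v, d (d v) = 0) (hd' : ∀ v, d' (d' v) = 0)
    (hA : ∀ v, A (d v) = d' (A v)) (v : WithCStarModule C (E × F)) :
    coneDifferential d d' A (coneDifferential d d' A v) = 0 := by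
  refine directSum_ext ?_ ?_ <;> simp [coneDifferential, hd, hd', hA]

/-- For a cone cycle `(v₁, v₂)`, injectivity on homology gives `v₁ = d z`, and surjectivity corrects
`z` by a cycle so that the second component is hit as well. -/
theorem IsQuasiIso.isExact_cone {d : Adjointable C E E} {d' : Adjointable C F F}
    {A : Adjointable C E F} (h : IsQuasiIso d d' A) (hA : ∀ v, A (d v) = d' (A v)) :
    IsExact (coneDifferential d d' A) := by
  intro v hv
  have h1 : d v.1 = 0 := by
    have := congrArg Prod.fst hv
    simpa [coneDifferential] using this
  have h2 : A v.1 + d' v.2 = 0 := congrArg Prod.snd hv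
  obtain ⟨z, hz⟩ := h.inj v.1 (-v.2) h1 (by rw [map_neg, eq_neg_iff_add_eq_zero, h2])
  obtain ⟨x, w, hx, hw⟩ := h.surj (v.2 + A z) (by rw [map_add, ← hA, ← hz, add_comm, h2])
  refine ⟨pair C (x - z) w, directSum_ext ?_ ?_⟩
  · simp [coneDifferential, hx, hz]
  · simp only [coneDifferential, block_snd, pair_fst, pair_snd, map_sub]
    rw [sub_add_eq_add_sub, ← hw, add_sub_cancel_right]

/-- The adjoint of the cone differential of `A` is, up to signs and the order of the summands, the
cone differential of `A*`, and exactness passes to adjoints. Exactness at `(u, y)` gives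
injectivity, at `(u, 0)` surjectivity. -/
theorem IsQuasiIso.adjoint [CompleteSpace E] [CompleteSpace F] {d : Adjointable C E E}
    {d' : Adjointable C F F} {A : Adjointable C E F} (h : IsQuasiIso d d' A)
    (hd : ∀ v, d (d v) = 0) (hd' : ∀ v, d' (d' v) = 0) (hA : ∀ v, A (d v) = d' (A v)) :
    IsQuasiIso d'.adjoint d.adjoint A.adjoint := by
  have hex := isExact_adjoint (coneDifferential_sq_zero hd hd' hA) (h.isExact_cone hA)
  refine ⟨fun y u hy hu => ?_, fun u hu => ?_⟩
  · obtain ⟨w, hw⟩ := hex (pair C u y) (directSum_ext (by simp [coneDifferential, hu])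
      (by simp [coneDifferential, hy]))
    have := congrArg Prod.snd hw
    refine ⟨w.2, ?_⟩
    simpa [coneDifferential] using this
  · obtain ⟨w, hw⟩ := hex (pair C u 0) (directSum_ext (by simp [coneDifferential, hu])
      (by simp [coneDifferential]))
    have h1 : u = -d.adjoint w.1 + A.adjoint w.2 := by
      simpa [coneDifferential] using congrArg Prod.fst hw
    have h2 : 0 = d'.adjoint w.2 := by
      simpa [coneDifferential] using congrArg Prod.snd hw
    exact ⟨w.2, -w.1, h2.symm, by rw [h1, map_neg, add_comm]⟩

/-- Poincaré duality makes the signature operators invertible. -/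
theorem isUnit_coneOperator [CompleteSpace E] {b S : Adjointable C E E}
    (hb : ∀ v, b (b v) = 0) (hchain : ∀ v, b (S v) + S (b.adjoint v) = 0)
    (h : IsQuasiIso b.adjoint b S) : IsUnit (coneOperator b S) := by
  refine isUnit_of_isExact (coneDifferential_sq_zero (fun v => ?_) hb fun v => ?_)
    (h.neg_left.isExact_cone fun v => ?_)
  · simp [adjoint_sq_zero hb]
  all_goals
    simpa [neg_eq_iff_add_eq_zero, add_comm] using hchain v

theorem coneOperator_apply {b S : Adjointable C E E} (hS : S.adjoint = S)
    (v : WithCStarModule C (E × E)) :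
    coneOperator b S v = pair C ((b + b.adjoint) v.1 + S v.2) ((b + b.adjoint) v.2 + S v.1) := by
  refine directSum_ext ?_ ?_
  · simp [coneOperator, coneOfDuality, coneDifferential, hS]
    abel
  · simp [coneOperator, coneOfDuality, coneDifferential]
    abel

/-- The operator `B_S` preserves the diagonal and acts there as `b + b* + S`, which inherits its
lower bound. For `b + b* - S` the antidiagonal plays the same role. -/
theorem isUnit_add_of_isUnit_coneOperator [CompleteSpace E] {b S : Adjointable C E E}
    (hS : S.adjoint = S) (h : IsUnit (coneOperator b S)) : IsUnit (b + b.adjoint + S) := by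
  obtain ⟨K, hK0, hK⟩ := exists_bound_of_isUnit h
  refine isUnit_of_bounded_below (K := K * 2) ?_ fun x => ?_
  · rw [star_eq_adjoint, adjoint_add, adjoint_add, adjoint_adjoint, hS, add_comm b]
  · have h1 := hK (pair C x x)
    rw [coneOperator_apply hS] at h1
    calc ‖x‖ ≤ ‖pair C x x‖ := norm_fst_le (pair C x x)
      _ ≤ _ := h1
      _ ≤ K * (‖(b + b.adjoint + S) x‖ + ‖(b + b.adjoint + S) x‖) := by
        gcongr
        exact WithCStarModule.prod_norm_le_norm_add _
      _ = _ := by ring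

theorem isUnit_sub_of_isUnit_coneOperator [CompleteSpace E] {b S : Adjointable C E E}
    (hS : S.adjoint = S) (h : IsUnit (coneOperator b S)) : IsUnit (b + b.adjoint - S) := by
  obtain ⟨K, hK0, hK⟩ := exists_bound_of_isUnit h
  refine isUnit_of_bounded_below (K := K * 2) ?_ fun x => ?_
  · rw [star_eq_adjoint, adjoint_sub, adjoint_add, adjoint_adjoint, hS, add_comm b]
  · have h1 := hK (pair C x (-x))
    rw [coneOperator_apply hS] at h1
    have e1 : (b + b.adjoint) x + S (-x) = (b + b.adjoint - S) x := by
      simp [sub_eq_add_neg]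
    have e2 : (b + b.adjoint) (-x) + S x = -(b + b.adjoint - S) x := by
      simp only [map_neg, Adjointable.sub_apply, neg_sub]; abel
    simp only [pair_fst, pair_snd, e1, e2] at h1
    calc ‖x‖ ≤ ‖pair C x (-x)‖ := norm_fst_le (pair C x (-x))
      _ ≤ _ := h1
      _ ≤ K * (‖(b + b.adjoint - S) x‖ + ‖-(b + b.adjoint - S) x‖) := by
        gcongr
        exact WithCStarModule.prod_norm_le_norm_add _
      _ = _ := by rw [norm_neg]; ring

end Exactness

/-! ### Signs of invertible self-adjoint operators -/

section Sign

variable {C : Type*} [NonUnitalCStarAlgebra C] [PartialOrder C] [StarOrderedRing C]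
  {E : Type*} [NormedAddCommGroup E] [NormedSpace ℂ E] [SMul C E] [CStarModule C E]
  {F : Type*} [NormedAddCommGroup F] [NormedSpace ℂ F] [SMul C F] [CStarModule C F]

/-- `s` is a self-adjoint involution with `s D ≥ 0`; for invertible self-adjoint `D` this is the
unitary part of the polar decomposition of `D`. -/
structure IsSign (D s : Adjointable C E E) : Prop where
  star_eq : star s = s
  mul_self : s * s = 1
  nonneg : ∃ c : Adjointable C E E, s * D = star c * c

theorem exists_isSign [CompleteSpace E] {D : Adjointable C E E} (hD : star D = D) (hu : IsUnit D) :
    ∃ s, IsSign D s := by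
  have hsa : IsSelfAdjoint D := hD
  have h0 : ∀ x ∈ spectrum ℝ D, x ≠ 0 := by
    rintro x hx rfl
    exact (spectrum.zero_notMem_iff ℝ).mpr hu hx
  -- Invertibility keeps zero out of the spectrum, so the sign function is continuous on it; `√|D|`
  -- witnesses the positivity of `s D = |D|`.
  have hf : ContinuousOn (fun x : ℝ => x * |x|⁻¹) (spectrum ℝ D) :=
    continuousOn_id.mul (continuous_abs.continuousOn.inv₀ fun x hx => abs_ne_zero.mpr (h0 x hx))
  refine ⟨cfc (fun x : ℝ => x * |x|⁻¹) D, ?_, ?_, cfc (fun x : ℝ => √|x|) D, ?_⟩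
  · exact cfc_predicate (R := ℝ) _ D
  · rw [← cfc_mul _ _ D hf hf, ← cfc_one ℝ D]
    refine cfc_congr fun x hx => ?_
    have := abs_ne_zero.mpr (h0 x hx)
    have h2 : x * x = |x| * |x| := (abs_mul_abs_self x).symm
    simp only [Pi.one_apply]
    field_simp
    nlinarith
  · have e : star (cfc (fun x : ℝ => √|x|) D) = cfc (fun x : ℝ => √|x|) D :=
      cfc_predicate (R := ℝ) _ D
    rw [e, ← cfc_mul _ _ D (by fun_prop) (by fun_prop)]
    nth_rw 2 [← cfc_id' ℝ D]
    rw [← cfc_mul _ (fun x : ℝ => x) D hf continuousOn_id]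
    refine cfc_congr fun x hx => ?_
    have := abs_ne_zero.mpr (h0 x hx)
    have h2 : x * x = |x| * |x| := (abs_mul_abs_self x).symm
    rw [Real.mul_self_sqrt (abs_nonneg x)]
    field_simp
    nlinarith

namespace IsSign

variable {D s : Adjointable C E E}

theorem comm (h : IsSign D s) (hD : star D = D) : s * D = D * s := by
  obtain ⟨c, hc⟩ := h.nonneg
  have : star (s * D) = s * D := by rw [hc, star_mul, star_star]
  rw [star_mul, h.star_eq, hD] at this
  exact this.symm

theorem neg (h : IsSign D s) : IsSign (-D) (-s) where
  star_eq := by rw [star_neg, h.star_eq]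
  mul_self := by rw [neg_mul_neg, h.mul_self]
  nonneg := by rw [neg_mul_neg]; exact h.nonneg

theorem conj (h : IsSign D s) {g : Adjointable C E E} (hg : star g = g) (hgg : g * g = 1) :
    IsSign (g * D * g) (g * s * g) where
  star_eq := by rw [star_mul, star_mul, hg, h.star_eq, mul_assoc]
  mul_self := by
    calc g * s * g * (g * s * g) = g * s * (g * g) * s * g := by simp only [mul_assoc]
      _ = g * (s * s) * g := by rw [hgg, mul_one]; simp only [mul_assoc]
      _ = 1 := by rw [h.mul_self, mul_one, hgg]
  nonneg := by
    obtain ⟨c, hc⟩ := h.nonneg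
    refine ⟨c * g, ?_⟩
    calc g * s * g * (g * D * g) = g * s * (g * g) * D * g := by simp only [mul_assoc]
      _ = g * (s * D) * g := by rw [hgg, mul_one]; simp only [mul_assoc]
      _ = _ := by rw [hc, star_mul, hg]; simp only [mul_assoc]

theorem block {D' s' : Adjointable C F F} (h : IsSign D s) (h' : IsSign D' s') :
    IsSign (Adjointable.block D 0 0 D') (Adjointable.block s 0 0 s') where
  star_eq := by
    have e1 : s.adjoint = s := h.star_eq
    have e2 : s'.adjoint = s' := h'.star_eq
    rw [star_eq_adjoint, block_adjoint, e1, e2, adjoint_zero, adjoint_zero]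
  mul_self := by
    have e1 : ∀ x, s (s x) = x := fun x => congrArg (fun T : Adjointable C E E => T x) h.mul_self
    have e2 : ∀ x, s' (s' x) = x := fun x =>
      congrArg (fun T : Adjointable C F F => T x) h'.mul_self
    refine ext_apply fun v => directSum_ext ?_ ?_ <;> simp [e1, e2]
  nonneg := by
    obtain ⟨c, hc⟩ := h.nonneg
    obtain ⟨c', hc'⟩ := h'.nonneg
    have e1 : ∀ x, s (D x) = c.adjoint (c x) := fun x =>
      congrArg (fun T : Adjointable C E E => T x) hc
    have e2 : ∀ x, s' (D' x) = c'.adjoint (c' x) := fun x =>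
      congrArg (fun T : Adjointable C F F => T x) hc'
    refine ⟨Adjointable.block c 0 0 c', ext_apply fun v => directSum_ext ?_ ?_⟩ <;>
      simp [star_eq_adjoint, e1, e2]

theorem inner_eq (h : IsSign D s) :
    ∃ c : Adjointable C E E, (∀ v w, inner C v (s (D w)) = inner C (c v) (c w)) ∧
      s * D = star c * c := by
  obtain ⟨c, hc⟩ := h.nonneg
  refine ⟨c, fun v w => ?_, hc⟩
  rw [← Adjointable.mul_apply, hc, Adjointable.mul_apply, star_eq_adjoint, inner_adjoint_right]

theorem isUnit (h : IsSign D s) : IsUnit s :=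
  ⟨⟨s, s, h.mul_self, h.mul_self⟩, rfl⟩

/-- Signs of nearby operators have an invertible sum. -/
theorem exists_isUnit_add [CompleteSpace E] (h : IsSign D s) (hu : IsUnit D) :
    ∃ δ : ℝ, 0 < δ ∧ ∀ D' s' : Adjointable C E E, IsSign D' s' → ‖D - D'‖ < δ →
      IsUnit (s + s') := by
  obtain ⟨c, hc, hsc⟩ := h.inner_eq
  obtain ⟨K, hK0, hK⟩ := exists_bound_of_isUnit (h.isUnit.mul hu)
  -- `s D = c* c` is invertible, so `c` is bounded below.
  obtain ⟨L, hL0, hL⟩ : ∃ L : ℝ, 0 < L ∧ ∀ v, ‖v‖ ≤ L * ‖c v‖ := by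
    refine ⟨K * (‖star c‖ + 1), by positivity, fun v => (hK v).trans ?_⟩
    rw [hsc, mul_assoc]
    have h1 : ‖(star c * c) v‖ ≤ ‖star c‖ * ‖c v‖ := le_norm (star c) (c v)
    have h2 := norm_nonneg (c v)
    gcongr
    nlinarith
  have hsn : ∀ {t : Adjointable C E E}, star t = t → t * t = 1 → ∀ v, ‖t v‖ = ‖v‖ := by
    intro t ht htt v
    have e : t (t v) = v := congrArg (fun T : Adjointable C E E => T v) htt
    have : ‖t v‖ ^ 2 = ‖v‖ ^ 2 := by
      rw [CStarModule.norm_sq_eq C, CStarModule.norm_sq_eq C, ← inner_adjoint,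
        ← star_eq_adjoint, ht, e]
    exact (sq_eq_sq₀ (norm_nonneg _) (norm_nonneg _)).mp this
  -- Below this threshold `2 ‖D - D'‖ < 1 / L²`, half of the lower bound `2 / L²` found in `n1`. The
  -- threshold does not depend on `D'`.
  refine ⟨1 / (2 * L ^ 2), by positivity, fun D' s' h' hlt => ?_⟩
  obtain ⟨c', hc', -⟩ := h'.inner_eq
  set δ := ‖D - D'‖ with hδ
  have hstar : star (s + s') = s + s' := by rw [star_add, h.star_eq, h'.star_eq]
  set η : ℝ := 1 / L ^ 2 - 2 * δ with hη
  have hη0 : 0 < η := by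
    have : 2 * (1 / (2 * L ^ 2)) = 1 / L ^ 2 := by field_simp
    rw [hη]; linarith
  refine isUnit_of_bounded_below (K := (‖D + D'‖) / η) hstar fun v => ?_
  -- The first bracket is positive and at least of order `‖v‖²` by the bound on `c`; the second is
  -- small with `D - D'`. Cauchy–Schwarz then bounds `s + s'` from below.
  have key : inner C ((s + s') v) ((D + D') v) = ((2 : ℂ) • inner C (c v) (c v) +
      (2 : ℂ) • inner C (c' v) (c' v)) - (inner C (s v) ((D - D') v) -
        inner C (s' v) ((D - D') v)) := by
    have a1 := hc v v
    have a2 := hc' v v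
    rw [← inner_adjoint, ← star_eq_adjoint, h.star_eq] at a1
    rw [← inner_adjoint, ← star_eq_adjoint, h'.star_eq] at a2
    rw [← a1, ← a2, two_smul, two_smul]
    simp only [Adjointable.add_apply, Adjointable.sub_apply, CStarModule.inner_add_left,
      CStarModule.inner_add_right, CStarModule.inner_sub_right]
    abel
  have n1 : ‖v‖ ^ 2 * (2 / L ^ 2) ≤ ‖(2 : ℂ) • inner C (c v) (c v) +
      (2 : ℂ) • inner C (c' v) (c' v)‖ := by
    have p1 : (0 : C) ≤ (2 : ℂ) • inner C (c v) (c v) := by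
      rw [two_smul]
      exact add_nonneg CStarModule.inner_self_nonneg CStarModule.inner_self_nonneg
    have p2 : (0 : C) ≤ (2 : ℂ) • inner C (c' v) (c' v) := by
      rw [two_smul]
      exact add_nonneg CStarModule.inner_self_nonneg CStarModule.inner_self_nonneg
    have := CStarAlgebra.norm_le_norm_of_nonneg_of_le p1 (le_add_of_nonneg_right p2)
    refine le_trans ?_ this
    rw [norm_smul, ← CStarModule.norm_sq_eq C]
    have := hL v
    have h3 : ‖v‖ ^ 2 ≤ L ^ 2 * ‖c v‖ ^ 2 := by
      rw [← mul_pow]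
      exact pow_le_pow_left₀ (norm_nonneg _) this 2
    simp only [Complex.norm_ofNat]
    rw [mul_div_assoc', div_le_iff₀ (by positivity)]
    linarith
  have n2 : ‖inner C (s v) ((D - D') v) - inner C (s' v) ((D - D') v)‖ ≤ 2 * δ * ‖v‖ ^ 2 := by
    have q := le_norm (D - D') v
    have q1 : ‖inner C (s v) ((D - D') v)‖ ≤ ‖v‖ * (δ * ‖v‖) := by
      refine (CStarModule.norm_inner_le E).trans ?_
      rw [hsn h.star_eq h.mul_self]
      gcongr
    have q2 : ‖inner C (s' v) ((D - D') v)‖ ≤ ‖v‖ * (δ * ‖v‖) := by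
      refine (CStarModule.norm_inner_le E).trans ?_
      rw [hsn h'.star_eq h'.mul_self]
      gcongr
    calc _ ≤ _ := norm_sub_le _ _
      _ ≤ ‖v‖ * (δ * ‖v‖) + ‖v‖ * (δ * ‖v‖) := add_le_add q1 q2
      _ = _ := by ring
  have n3 : ‖v‖ ^ 2 * (2 / L ^ 2) - 2 * δ * ‖v‖ ^ 2 ≤ ‖(s + s') v‖ * (‖D + D'‖ * ‖v‖) := by
    calc _ ≤ ‖inner C ((s + s') v) ((D + D') v)‖ := by
          rw [key]
          exact (sub_le_sub n1 n2).trans (norm_sub_norm_le _ _)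
      _ ≤ ‖(s + s') v‖ * ‖(D + D') v‖ := CStarModule.norm_inner_le E
      _ ≤ _ := by gcongr; exact le_norm _ _
  have n4 : η * ‖v‖ ^ 2 ≤ ‖D + D'‖ * ‖(s + s') v‖ * ‖v‖ := by
    have : 2 / L ^ 2 = 1 / L ^ 2 + 1 / L ^ 2 := by ring
    have hp : 0 ≤ 1 / L ^ 2 * ‖v‖ ^ 2 := by positivity
    rw [hη]
    nlinarith
  rw [div_mul_eq_mul_div, le_div_iff₀ hη0]
  rcases (norm_nonneg v).eq_or_lt with h0 | h0
  · rw [← h0, zero_mul]; positivity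
  · nlinarith

end IsSign

/-! ### Classes of positive projections -/

/-- Expanding `a (β.x i)` in the dual basis `γ` turns the matrix product into the composite `c ∘ a`.
The factors appear in reverse order because the algebra acts on the left. -/
theorem matrix_mul_eq_projectionMatrix {m m' : ℕ} (β : DualBasis C E m) (γ : DualBasis C F m')
    {P : Adjointable C E E} (hP : ∀ v, P (P v) = P v) (a : Adjointable C E F)
    (c : Adjointable C F E) (hca : ∀ v, c (a v) = P v) :
    (Matrix.of fun i k => ((inner C (γ.y k) (a (β.x i)) : C) : Unitization ℂ C) :
        Matrix (Fin m) (Fin m') (Unitization ℂ C)) *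
      (Matrix.of fun i k => ((inner C (β.y k) (c (γ.x i)) : C) : Unitization ℂ C) :
        Matrix (Fin m') (Fin m) (Unitization ℂ C)) = (projectionMatrix β P hP).mat := by
  ext1 i k
  simp only [Matrix.mul_apply, Matrix.of_apply, ← Unitization.inr_mul, projectionMatrix]
  refine (map_sum (Unitization.inrNonUnitalStarAlgHom ℂ C)
    (fun j => inner C (γ.y j) (a (β.x i)) * inner C (β.y k) (c (γ.x j)))
    Finset.univ).symm.trans ?_
  rw [γ.sum_inner_mul_inner c (a (β.x i)) (β.y k), hca]
  rfl

/-- Isomorphic ranges have the same class. -/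
theorem projectionClass_eq_of_intertwining {m m' : ℕ} (β : DualBasis C E m)
    (γ : DualBasis C F m') {P : Adjointable C E E} (hP : ∀ v, P (P v) = P v)
    {Q : Adjointable C F F} (hQ : ∀ v, Q (Q v) = Q v) (a : Adjointable C E F)
    (c : Adjointable C F E) (hca : ∀ v, c (a v) = P v) (hac : ∀ v, a (c v) = Q v) :
    projectionClass β P hP = projectionClass γ Q hQ :=
  Subtype.ext (congrArg Algebra.GrothendieckAddGroup.of (IdempotentClass.mk_eq_mk
    ⟨_, _, matrix_mul_eq_projectionMatrix β γ hP a c hca,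
      matrix_mul_eq_projectionMatrix γ β hQ c a hac⟩))

theorem smul_alg_zero (a : C) : a • (0 : E) = 0 :=
  (map_smul_alg (0 : Adjointable C E E) a 0).symm

/-- Dual bases of two modules give one of the direct sum. -/
noncomputable def DualBasis.directSum {m m' : ℕ} (β : DualBasis C E m) (γ : DualBasis C F m') :
    DualBasis C (WithCStarModule C (E × F)) (m + m') where
  x := Fin.addCases (fun i => pair C (β.x i) 0) (fun i => pair C 0 (γ.x i))
  y := Fin.addCases (fun i => pair C (β.y i) 0) (fun i => pair C 0 (γ.y i))
  expand v := by
    have hp : ∀ (a : C) (x : E) (y : F), a • pair C x y = pair C (a • x) (a • y) :=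
      fun _ _ _ => rfl
    simp only [Fin.sum_univ_add, Fin.addCases_left, Fin.addCases_right, WithCStarModule.prod_inner,
      pair_fst, pair_snd, CStarModule.inner_zero_left, add_zero, zero_add, hp, smul_alg_zero]
    have e1 : ∑ i, pair C (inner C (β.y i) v.1 • β.x i) (0 : F) = inl C E F v.1 := by
      rw [← β.expand v.1, map_sum, β.expand]; rfl
    have e2 : ∑ i, pair C (0 : E) (inner C (γ.y i) v.2 • γ.x i) = inr C E F v.2 := by
      rw [← γ.expand v.2, map_sum, γ.expand]; rfl
    rw [e1, e2]
    exact directSum_ext (by simp) (by simp)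

theorem projectionClass_block {m m' : ℕ} (β : DualBasis C E m) (γ : DualBasis C F m')
    {P : Adjointable C E E} (hP : ∀ v, P (P v) = P v) {Q : Adjointable C F F}
    (hQ : ∀ v, Q (Q v) = Q v)
    (hPQ : ∀ v, Adjointable.block P 0 0 Q (Adjointable.block P 0 0 Q v) =
      Adjointable.block P 0 0 Q v) :
    projectionClass (β.directSum γ) (Adjointable.block P 0 0 Q) hPQ =
      projectionClass β P hP + projectionClass γ Q hQ := by
  refine Subtype.ext ?_
  have h : IdempotentClass.mk (projectionMatrix (β.directSum γ) (Adjointable.block P 0 0 Q) hPQ) =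
      IdempotentClass.mk (projectionMatrix β P hP) +
        IdempotentClass.mk (projectionMatrix γ Q hQ) := by
    rw [IdempotentClass.mk_add_mk]
    have hM : (projectionMatrix (β.directSum γ) (Adjointable.block P 0 0 Q) hPQ).mat =
        ((projectionMatrix β P hP).blockSum (projectionMatrix γ Q hQ)).mat := by
      ext1 i k
      change ((inner C ((β.directSum γ).y k)
        (Adjointable.block P 0 0 Q ((β.directSum γ).x i)) : C) : Unitization ℂ C) =
          Matrix.fromBlocks
            (Matrix.of fun i k => ((inner C (β.y k) (P (β.x i)) : C) : Unitization ℂ C)) 0 0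
            (Matrix.of fun i k => ((inner C (γ.y k) (Q (γ.x i)) : C) : Unitization ℂ C))
            ((finSumFinEquiv : Fin m ⊕ Fin m' ≃ Fin (m + m')).symm i)
            ((finSumFinEquiv : Fin m ⊕ Fin m' ≃ Fin (m + m')).symm k)
      refine Fin.addCases (fun i => ?_) (fun i => ?_) i <;>
        refine Fin.addCases (fun k => ?_) (fun k => ?_) k <;>
        simp [DualBasis.directSum, WithCStarModule.prod_inner]
    refine IdempotentClass.mk_eq_mk ?_
    rw [hM]
    exact MatrixEquivalent.refl (IdempotentMatrix.idem _)
  exact (congrArg Algebra.GrothendieckAddGroup.of h).trans (map_add _ _ _)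

/-- The projection onto the `+1` eigenspace of an involution. -/
noncomputable def posProj (s : Adjointable C E E) : Adjointable C E E := (1 / 2 : ℂ) • (1 + s)

theorem posProj_idem {s : Adjointable C E E} (hs : s * s = 1) (v : E) :
    posProj s (posProj s v) = posProj s v := by
  have e1 : s (s v) = v := congrArg (fun T : Adjointable C E E => T v) hs
  simp only [posProj, Adjointable.smul_apply, Adjointable.add_apply, Adjointable.one_apply,
    map_smul, map_add, e1]
  module

/-- The class in `K₀` of the `+1` eigenspace of an involution. -/
noncomputable def signClass {m : ℕ} (β : DualBasis C E m) (s : Adjointable C E E)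
    (hs : s * s = 1) : K0 C := projectionClass β (posProj s) (posProj_idem hs)

/-- If `P`, `P'` are the two positive projections, then `P g = g P'`, and `g⁻¹ P` and `P g`
implement the equivalence of `P` with `P'`. -/
theorem signClass_eq_of_mul_eq {m : ℕ} (β : DualBasis C E m) {s s' : Adjointable C E E}
    (hs : s * s = 1) (hs' : s' * s' = 1) {g : Adjointable C E E} (hg : IsUnit g)
    (h : s * g = g * s') : signClass β s hs = signClass β s' hs' := by
  obtain ⟨u, rfl⟩ := hg
  have hP : posProj s * u = u * posProj s' := by
    rw [posProj, posProj, smul_mul_assoc, mul_smul_comm, add_mul, mul_add, h, one_mul, mul_one]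
  have hi : posProj s * posProj s = posProj s := ext_apply (posProj_idem hs)
  have hi' : posProj s' * posProj s' = posProj s' := ext_apply (posProj_idem hs')
  refine projectionClass_eq_of_intertwining β β _ _ ((u⁻¹ : (Adjointable C E E)ˣ) * posProj s)
    (posProj s * u) (fun v => ?_) (fun v => ?_)
  · rw [← Adjointable.mul_apply]
    congr 2
    rw [mul_assoc, Units.mul_inv_cancel_left, hi]
  · rw [← Adjointable.mul_apply]
    congr 2
    rw [mul_assoc, ← mul_assoc (posProj s), hi, hP, Units.inv_mul_cancel_left]

theorem signClass_block {m m' : ℕ} (β : DualBasis C E m) (γ : DualBasis C F m')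
    {s : Adjointable C E E} {s' : Adjointable C F F} (hs : s * s = 1) (hs' : s' * s' = 1)
    (hss : Adjointable.block s 0 0 s' * Adjointable.block s 0 0 s' = 1) :
    signClass (β.directSum γ) (Adjointable.block s 0 0 s') hss =
      signClass β s hs + signClass γ s' hs' := by
  have e : posProj (Adjointable.block s 0 0 s') =
      Adjointable.block (posProj s) 0 0 (posProj s') := by
    refine ext_apply fun v => directSum_ext ?_ ?_ <;> simp [posProj]
  rw [signClass, signClass, signClass, ← projectionClass_block β γ _ _ (e ▸ posProj_idem hss)]
  congr 1

/-- An arbitrarily chosen sign suffices: `s + s'` is invertible and `s (s + s') = 1 + s s' = (s +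
s') s'`. -/
theorem IsSign.signClass_eq [CompleteSpace E] {m : ℕ} (β : DualBasis C E m)
    {D s s' : Adjointable C E E} (h : IsSign D s) (h' : IsSign D s') (hu : IsUnit D) : signClass β s h.mul_self = signClass β s' h'.mul_self := by
  obtain ⟨δ, hδ, H⟩ := h.exists_isUnit_add hu
  refine signClass_eq_of_mul_eq β _ _ (H D s' h' (by rwa [sub_self, norm_zero])) ?_
  rw [mul_add, add_mul, h.mul_self, h'.mul_self, add_comm]

/-- Homotopy invariance of the class of the positive eigenspace. -/
theorem IsSign.signClass_eq_of_homotopy [CompleteSpace E] {m : ℕ} (β : DualBasis C E m)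
    (D : ℝ → Adjointable C E E) (hc : Continuous D) (hD : ∀ t, star (D t) = D t)
    (hu : ∀ t, IsUnit (D t)) {t₀ t₁ : ℝ} {s₀ s₁ : Adjointable C E E} (h₀ : IsSign (D t₀) s₀)
    (h₁ : IsSign (D t₁) s₁) : signClass β s₀ h₀.mul_self = signClass β s₁ h₁.mul_self := by
  choose s hs using fun t => exists_isSign (hD t) (hu t)
  -- Nearby signs `s`, `s'` are intertwined by the invertible `s + s'`, so the class is locally
  -- constant on the connected real line.
  have hloc : IsLocallyConstant fun t => signClass β (s t) (hs t).mul_self := by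
    rw [IsLocallyConstant.iff_eventually_eq]
    intro t
    obtain ⟨δ, hδ, H⟩ := (hs t).exists_isUnit_add (hu t)
    have hev : ∀ᶠ r in nhds t, ‖D t - D r‖ < δ := by
      have : Filter.Tendsto (fun r => ‖D t - D r‖) (nhds t) (nhds ‖D t - D t‖) :=
        ((continuous_const.sub hc).norm).tendsto t
      rw [sub_self, norm_zero] at this
      exact this.eventually_lt_const hδ
    filter_upwards [hev] with r hr
    refine (signClass_eq_of_mul_eq β _ _ (H _ _ (hs r) hr) ?_).symm
    rw [mul_add, add_mul, (hs t).mul_self, (hs r).mul_self, add_comm]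
  rw [h₀.signClass_eq β (hs t₀) (hu t₀), h₁.signClass_eq β (hs t₁) (hu t₁)]
  exact hloc.apply_eq_of_isPreconnected isPreconnected_univ (Set.mem_univ _) (Set.mem_univ _)

end Sign

section Signature

variable {C : Type*} [NonUnitalCStarAlgebra C] [PartialOrder C] [StarOrderedRing C]
  {E : Type*} [NormedAddCommGroup E] [NormedSpace ℂ E] [SMul C E] [CStarModule C E]
  {F : Type*} [NormedAddCommGroup F] [NormedSpace ℂ F] [SMul C F] [CStarModule C F]

/-! ### Signatures in terms of signs -/

theorem IsSign.isPositiveProjectionOn {D s : Adjointable C E E} (h : IsSign D s)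
    (hD : star D = D) : IsPositiveProjectionOn D (posProj s) Set.univ := by
  obtain ⟨c, hc, -⟩ := h.inner_eq
  have hss : ∀ v, s (s v) = v := fun v =>
    congrArg (fun T : Adjointable C E E => T v) h.mul_self
  have hcomm : ∀ v, s (D v) = D (s v) := fun v =>
    congrArg (fun T : Adjointable C E E => T v) (h.comm hD)
  have hs : s.adjoint = s := h.star_eq
  have hPv : ∀ v, posProj s v = (1 / 2 : ℂ) • (v + s v) := fun v => rfl
  refine ⟨?_, posProj_idem h.mul_self, fun _ => Set.mem_univ _, fun v => ?_, fun v _ => ?_,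
    fun v _ => ?_⟩
  · refine ext_apply fun v => ?_
    change star (1 / 2 : ℂ) • (v + s.adjoint v) = (1 / 2 : ℂ) • (v + s v)
    rw [hs]
    norm_num
  · rw [hPv, hPv, map_smul, map_add, hcomm]
  · have e : s (posProj s v) = posProj s v := by
      rw [hPv, map_smul, map_add, hss, add_comm]
    have e2 : D (posProj s v) = s (D (posProj s v)) := by rw [hcomm, e]
    rw [e2, hc]
    exact CStarModule.inner_self_nonneg
  · have e : s (v - posProj s v) = -(v - posProj s v) := by
      rw [hPv, map_sub, map_smul, map_add, hss]
      module
    have e2 : D (v - posProj s v) = -s (D (v - posProj s v)) := by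
      rw [hcomm, e, map_neg, neg_neg]
    rw [e2, CStarModule.inner_neg_right, hc]
    exact neg_nonpos.mpr CStarModule.inner_self_nonneg

/-- The operator `P` on the `+1` eigenspace of the symmetry of `E ⊕ E`, which is identified with
`E` by the diagonal, extended by zero to the `-1` eigenspace. -/
noncomputable def diagonalExtension (P : Adjointable C E E) :
    Adjointable C (WithCStarModule C (E × E)) (WithCStarModule C (E × E)) :=
  Adjointable.block ((1 / 2 : ℂ) • P) ((1 / 2 : ℂ) • P) ((1 / 2 : ℂ) • P) ((1 / 2 : ℂ) • P)

theorem diagonalExtension_apply (P : Adjointable C E E) (v : WithCStarModule C (E × E)) :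
    diagonalExtension P v =
      pair C ((1 / 2 : ℂ) • P (v.1 + v.2)) ((1 / 2 : ℂ) • P (v.1 + v.2)) :=
  directSum_ext (by simp [diagonalExtension]) (by simp [diagonalExtension])

theorem IsPositiveProjectionOn.diagonalExtension {D P : Adjointable C E E}
    (h : IsPositiveProjectionOn D P Set.univ)
    {B : Adjointable C (WithCStarModule C (E × E)) (WithCStarModule C (E × E))}
    (hB : ∀ v, (B v).1 + (B v).2 = D (v.1 + v.2))
    (hB' : ∀ x, B (pair C x x) = pair C (D x) (D x)) :
    IsPositiveProjectionOn B (diagonalExtension P) (symmetricPart C E) := by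
  have hsym : ∀ v ∈ symmetricPart C E, ∃ x, v = pair C x x := by
    intro v hv
    have h1 := congrArg Prod.fst hv
    simp only [block_fst, Adjointable.zero_apply, zero_add, Adjointable.id_apply] at h1
    exact ⟨v.1, directSum_ext rfl h1⟩
  have hdiag : ∀ x, HilbertPoincare.diagonalExtension P (pair C x x) = pair C (P x) (P x) := by
    intro x
    rw [diagonalExtension_apply, pair_fst, pair_snd, map_add, ← two_smul ℂ (P x), smul_smul]
    norm_num
  refine ⟨?_, fun v => ?_, fun v => ?_, fun v => ?_, ?_, ?_⟩
  · rw [HilbertPoincare.diagonalExtension, block_adjoint, adjoint_smul, h.selfAdjoint]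
    norm_num
  · conv_lhs => rw [diagonalExtension_apply P v]
    rw [hdiag, map_smul, h.idem, diagonalExtension_apply]
  · rw [diagonalExtension_apply]
    exact directSum_ext (by simp) (by simp)
  · rw [diagonalExtension_apply, hB, diagonalExtension_apply, hB', h.comm, map_smul]
  · intro v hv
    obtain ⟨x, rfl⟩ := hsym v hv
    rw [hdiag, hB', WithCStarModule.prod_inner]
    exact add_nonneg (h.nonneg x (Set.mem_univ _)) (h.nonneg x (Set.mem_univ _))
  · intro v hv
    obtain ⟨x, rfl⟩ := hsym v hv
    have e : pair C x x - pair C (P x) (P x) = pair C (x - P x) (x - P x) := rfl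
    rw [hdiag, e, hB', WithCStarModule.prod_inner]
    exact add_nonpos (h.nonpos x (Set.mem_univ _)) (h.nonpos x (Set.mem_univ _))

theorem projectionClass_diagonalExtension {m m' : ℕ} (β : DualBasis C E m)
    (γ : DualBasis C (WithCStarModule C (E × E)) m') {P : Adjointable C E E}
    (hP : ∀ v, P (P v) = P v)
    (hP' : ∀ v, diagonalExtension P (diagonalExtension P v) = diagonalExtension P v) :
    projectionClass γ (diagonalExtension P) hP' = projectionClass β P hP := by
  refine (projectionClass_eq_of_intertwining β γ hP hP' ((inl C E E + inr C E E).comp P)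
    ((1 / 2 : ℂ) • P.comp ((inl C E E).adjoint + (inr C E E).adjoint)) (fun v => ?_)
    (fun v => ?_)).symm
  · simp only [Adjointable.smul_apply, Adjointable.comp_apply, Adjointable.add_apply,
      inl_adjoint_apply, inr_adjoint_apply, inl_fst,
      inl_snd, inr_fst, inr_snd, add_zero, zero_add, map_add, hP]
    module
  · rw [diagonalExtension_apply]
    refine directSum_ext ?_ ?_ <;> simp [hP]

theorem hasHigsonRoeSignature_zero [CompleteSpace E] {b S : Adjointable C E E} {m : ℕ}
    (β : DualBasis C E m) (hS : S.adjoint = S) (hu : IsUnit (coneOperator b S))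
    {s s' : Adjointable C E E} (hs : IsSign (b + b.adjoint + S) s)
    (hs' : IsSign (b + b.adjoint - S) s')
    (h : signClass β s hs.mul_self = signClass β s' hs'.mul_self) :
    HasHigsonRoeSignature b S 0 := by
  have h1 : star (b + b.adjoint + S) = b + b.adjoint + S := by
    rw [star_eq_adjoint, adjoint_add, adjoint_add, adjoint_adjoint, hS, add_comm b]
  have h2 : star (b + b.adjoint - S) = b + b.adjoint - S := by
    rw [star_eq_adjoint, adjoint_sub, adjoint_add, adjoint_adjoint, hS, add_comm b]
  exact ⟨bijective_of_isUnit (isUnit_add_of_isUnit_coneOperator hS hu),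
    bijective_of_isUnit (isUnit_sub_of_isUnit_coneOperator hS hu), m, β, posProj s, posProj s',
    hs.isPositiveProjectionOn h1, hs'.isPositiveProjectionOn h2, (sub_eq_zero.mpr h).symm⟩

theorem hasMishchenkoSignature_zero [CompleteSpace E] {b S : Adjointable C E E} {m : ℕ}
    (β : DualBasis C E m) (hS : S.adjoint = S) (hu : IsUnit (coneOperator b S))
    {s s' : Adjointable C E E} (hs : IsSign (b + b.adjoint + S) s)
    (hs' : IsSign (-(b + b.adjoint + S)) s')
    (h : signClass β s hs.mul_self = signClass β s' hs'.mul_self) :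
    HasMishchenkoSignature b S 0 := by
  have h1 : star (b + b.adjoint + S) = b + b.adjoint + S := by
    rw [star_eq_adjoint, adjoint_add, adjoint_add, adjoint_adjoint, hS, add_comm b]
  have h2 : star (-(b + b.adjoint + S)) = -(b + b.adjoint + S) := by rw [star_neg, h1]
  have hB : ∀ v, (coneOperator b S v).1 + (coneOperator b S v).2 =
      (b + b.adjoint + S) (v.1 + v.2) := fun v => by
    rw [coneOperator_apply hS]
    simp only [pair_fst, pair_snd, Adjointable.add_apply, map_add]
    abel
  have hB' : ∀ x, coneOperator b S (pair C x x) =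
      pair C ((b + b.adjoint + S) x) ((b + b.adjoint + S) x) := fun x => by
    rw [coneOperator_apply hS]
    rfl
  have hP := (hs.isPositiveProjectionOn h1).diagonalExtension hB hB'
  have hQ : IsNegativeProjectionOn (coneOperator b S) (diagonalExtension (posProj s'))
      (symmetricPart C E) := by
    refine (hs'.isPositiveProjectionOn h2).diagonalExtension (fun v => ?_) (fun x => ?_)
    · rw [Adjointable.neg_apply, Adjointable.neg_apply, ← hB, directSum_neg_fst,
        directSum_neg_snd, neg_add]
    · rw [Adjointable.neg_apply, hB']
      rfl
  refine ⟨bijective_of_isUnit hu, m + m, β.directSum β, _, _, hP, hQ, ?_⟩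
  rw [projectionClass_diagonalExtension β _ (posProj_idem hs.mul_self),
    projectionClass_diagonalExtension β _ (posProj_idem hs'.mul_self)]
  exact (sub_eq_zero.mpr h).symm

/-! ### The rotation homotopy -/

/-- Let `f : (F, d) → (E, b)` be a homology isomorphism transporting the duality `σ` of `(F, d)` to
`S`, up to homotopy. Then all the rotations connecting `S ⊕ -σ` to `-S ⊕ σ` are dualities. -/
theorem isQuasiIso_rotation {b S h k : Adjointable C E E} {d σ : Adjointable C F F}
    {f : Adjointable C F E} (hσ : ∀ x, σ (σ x) = x)
    (hdσ : ∀ x, d (σ x) + σ (d.adjoint x) = 0)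
    (hf' : ∀ x, f.adjoint (b.adjoint x) = d.adjoint (f.adjoint x))
    (hf : ∀ x, f (d x) = b (f x))
    (hS : ∀ x, S x = f (σ (f.adjoint x)) + b (h x) + k (b.adjoint x))
    (q : IsQuasiIso d b f) (q' : IsQuasiIso b.adjoint d.adjoint f.adjoint) {c s : ℂ}
    (hcs : c * c + s * s = 1) :
    IsQuasiIso (Adjointable.block b.adjoint 0 0 d.adjoint) (Adjointable.block b 0 0 d)
      (Adjointable.block (c • S) (s • f.comp σ) (s • σ.comp f.adjoint) (-(c • σ))) := by
  have hdσ1 : ∀ x, σ (d.adjoint x) = -d (σ x) := fun x => by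
    rw [eq_neg_iff_add_eq_zero, add_comm, hdσ]
  have hdσ2 : ∀ x, σ (d x) = -d.adjoint (σ x) := fun x => by
    have := hdσ1 (σ x)
    rw [hσ] at this
    rw [eq_neg_iff_add_eq_zero, ← neg_eq_iff_add_eq_zero, ← map_neg, ← this, hσ]
  have hdσ3 : ∀ x, d.adjoint (σ x) = -σ (d x) := fun x => by rw [hdσ2, neg_neg]
  have hdσ4 : ∀ x, d (σ x) = -σ (d.adjoint x) := fun x => by rw [hdσ1, neg_neg]
  refine ⟨fun v w hv hw => ?_, fun v hv => ?_⟩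
  · have hv1 : b.adjoint v.1 = 0 := by simpa using congrArg Prod.fst hv
    have hv2 : d.adjoint v.2 = 0 := by simpa using congrArg Prod.snd hv
    have hw1 : c • S v.1 + s • f (σ v.2) = b w.1 := by simpa using congrArg Prod.fst hw
    have hw2 : s • σ (f.adjoint v.1) + -(c • σ v.2) = d w.2 := by
      simpa using congrArg Prod.snd hw
    set p := f.adjoint v.1 with hp
    have hdp : d.adjoint p = 0 := by rw [hp, ← hf', hv1, map_zero]
    -- Modulo boundaries `S v₁` is `f σ f* v₁`, since `b* v₁ = 0` removes the term with `k`. So `f`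
    -- sends this cycle to a boundary.
    obtain ⟨z, hz⟩ := q.inj (σ (c • p + s • v.2)) (w.1 - c • h v.1)
      (by rw [hdσ4, map_add, map_smul, map_smul, hdp, hv2]; simp)
      (by
        rw [map_sub, ← hw1, hS, hv1, ← hp]
        simp only [map_add, map_smul, map_zero]
        module)
    have e1 : c • σ p + s • σ v.2 = d z := by rw [← hz, map_add, map_smul, map_smul]
    -- The matrix with rows `(c, s)` and `(s, -c)` is its own inverse; applying it to `e1` and `hw2`
    -- solves for `σ p` and `σ v₂`.
    have e2 : σ p = d (c • z + s • w.2) := by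
      rw [map_add, map_smul, map_smul, ← e1, ← hw2]
      calc σ p = (1 : ℂ) • σ p := (one_smul _ _).symm
        _ = _ := by rw [← hcs]; module
    have e3 : σ v.2 = d (s • z - c • w.2) := by
      rw [map_sub, map_smul, map_smul, ← e1, ← hw2]
      calc σ v.2 = (1 : ℂ) • σ v.2 := (one_smul _ _).symm
        _ = _ := by rw [← hcs]; module
    obtain ⟨u, hu⟩ := q'.inj v.1 (-σ (c • z + s • w.2)) hv1
      (by rw [← hp, map_neg, ← hdσ2, ← e2, hσ])
    refine ⟨pair C u (-σ (s • z - c • w.2)), directSum_ext ?_ ?_⟩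
    · simp [hu]
    · rw [block_snd, pair_fst, pair_snd, Adjointable.zero_apply, zero_add, map_neg, ← hdσ2, ← e3,
        hσ]
  · have hv1 : b v.1 = 0 := by simpa using congrArg Prod.fst hv
    have hv2 : d v.2 = 0 := by simpa using congrArg Prod.snd hv
    obtain ⟨y, u, hy, hyu⟩ := q.surj v.1 hv1
    -- Here `y` represents `v₁` under `f`. The same involution applied to `(y, v₂)`, followed by
    -- `σ`, gives the desired preimage; its first component is lifted through `f*`.
    obtain ⟨e, z, he, hez⟩ := q'.surj (σ (c • y + s • v.2))
      (by rw [hdσ3, map_add, map_smul, map_smul, hy, hv2]; simp)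
    have hfe : f.adjoint e = σ (c • y + s • v.2) - d.adjoint z := by rw [hez, add_sub_cancel_right]
    have hσfe : σ (f.adjoint e) = c • y + s • v.2 + d (σ z) := by
      rw [hfe, map_sub, hσ, hdσ1, sub_neg_eq_add]
    refine ⟨pair C e (σ (s • y - c • v.2)), pair C (u - c • (f (σ z) + h e)) (-(s • σ z)),
      directSum_ext ?_ ?_, directSum_ext ?_ ?_⟩
    · simp [he]
    · simp [hdσ3, hy, hv2]
    · simp only [block_fst, directSum_add_fst, pair_fst, pair_snd, Adjointable.smul_apply,
        Adjointable.comp_apply, Adjointable.zero_apply, hS e, hσfe, hσ, he, map_add, map_sub,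
        map_smul, map_zero, hf]
      calc v.1 = (1 : ℂ) • f y + b u := by rw [one_smul, ← hyu]
        _ = _ := by rw [← hcs]; module
    · simp only [block_snd, directSum_add_snd, pair_fst, pair_snd, Adjointable.smul_apply,
        Adjointable.comp_apply, Adjointable.zero_apply, Adjointable.neg_apply, hσfe, hσ, map_neg,
        map_smul]
      calc v.2 = (1 : ℂ) • v.2 := (one_smul _ _).symm
        _ = _ := by rw [← hcs]; module

/-- At the angle zero the rotation is the diagonal operator `S ⊕ -σ`; its first summand is the
assertion. -/
theorem isQuasiIso_of_transport {b S h k : Adjointable C E E} {d σ : Adjointable C F F}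
    {f : Adjointable C F E} (hσ : ∀ x, σ (σ x) = x)
    (hdσ : ∀ x, d (σ x) + σ (d.adjoint x) = 0)
    (hf' : ∀ x, f.adjoint (b.adjoint x) = d.adjoint (f.adjoint x))
    (hf : ∀ x, f (d x) = b (f x))
    (hS : ∀ x, S x = f (σ (f.adjoint x)) + b (h x) + k (b.adjoint x))
    (q : IsQuasiIso d b f) (q' : IsQuasiIso b.adjoint d.adjoint f.adjoint) :
    IsQuasiIso b.adjoint b S := by
  have Q := isQuasiIso_rotation hσ hdσ hf' hf hS q q' (c := 1) (s := 0) (by norm_num)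
  refine ⟨fun x y hx hy => ?_, fun y hy => ?_⟩
  · obtain ⟨z, hz⟩ := Q.inj (pair C x 0) (pair C y 0) (directSum_ext (by simp [hx]) (by simp))
      (directSum_ext (by simp [hy]) (by simp))
    exact ⟨z.1, by simpa using congrArg Prod.fst hz⟩
  · obtain ⟨x, z, hx, hz⟩ := Q.surj (pair C y 0) (directSum_ext (by simp [hy]) (by simp))
    exact ⟨x.1, z.1, by simpa using congrArg Prod.fst hx, by simpa using congrArg Prod.fst hz⟩

/-- Follows the rotation from angle `0` to angle `π`, which reverses both dualities while the
differential `b ⊕ d` stays fixed. -/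
theorem signClass_add_eq_of_transport [CompleteSpace E] [CompleteSpace F] {m m' : ℕ}
    (β : DualBasis C E m) (γ : DualBasis C F m')
    {b S h k : Adjointable C E E} {d σ : Adjointable C F F} {f : Adjointable C F E}
    (hb : ∀ x, b (b x) = 0) (hd : ∀ x, d (d x) = 0) (hSa : S.adjoint = S) (hσa : σ.adjoint = σ)
    (hbS : ∀ x, b (S x) + S (b.adjoint x) = 0)
    (hσ : ∀ x, σ (σ x) = x) (hdσ : ∀ x, d (σ x) + σ (d.adjoint x) = 0)
    (hf' : ∀ x, f.adjoint (b.adjoint x) = d.adjoint (f.adjoint x))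
    (hf : ∀ x, f (d x) = b (f x))
    (hS : ∀ x, S x = f (σ (f.adjoint x)) + b (h x) + k (b.adjoint x))
    (q : IsQuasiIso d b f) (q' : IsQuasiIso b.adjoint d.adjoint f.adjoint)
    {s₀ s₁ : Adjointable C E E} {r₀ r₁ : Adjointable C F F}
    (hs₀ : IsSign (b + b.adjoint + S) s₀) (hs₁ : IsSign (b + b.adjoint - S) s₁)
    (hr₀ : IsSign (d + d.adjoint - σ) r₀) (hr₁ : IsSign (d + d.adjoint + σ) r₁) :
    signClass β s₀ hs₀.mul_self + signClass γ r₀ hr₀.mul_self =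
      signClass β s₁ hs₁.mul_self + signClass γ r₁ hr₁.mul_self := by
  let B := Adjointable.block b 0 0 d
  let X := Adjointable.block S 0 0 (-σ)
  let Y := Adjointable.block 0 (f.comp σ) (σ.comp f.adjoint) 0
  let R : ℝ → Adjointable C (WithCStarModule C (E × F)) (WithCStarModule C (E × F)) :=
    fun t => (Real.cos t : ℂ) • X + (Real.sin t : ℂ) • Y
  have hR : ∀ t, R t = Adjointable.block ((Real.cos t : ℂ) • S) ((Real.sin t : ℂ) • f.comp σ)
      ((Real.sin t : ℂ) • σ.comp f.adjoint) (-((Real.cos t : ℂ) • σ)) := fun t => by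
    refine ext_apply fun v => directSum_ext ?_ ?_
    · simp [R, X, Y]
    · simp [R, X, Y]
      abel
  have hRa : ∀ t, (R t).adjoint = R t := fun t => by
    have e1 : X.adjoint = X := by simp [X, hSa, hσa]
    have e2 : Y.adjoint = Y := by simp [Y, hσa]
    simp only [R, adjoint_add, adjoint_smul, e1, e2, Complex.star_def, Complex.conj_ofReal]
  have hB : ∀ v, B (B v) = 0 := fun v => by
    refine directSum_ext ?_ ?_ <;> simp [B, hb, hd]
  have hchain : ∀ t v, B (R t v) + R t (B.adjoint v) = 0 := fun t v => by
    have e1 : ∀ x, S (b.adjoint x) = -b (S x) := fun x => by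
      rw [eq_neg_iff_add_eq_zero, add_comm, hbS]
    have e2 : ∀ x, σ (d.adjoint x) = -d (σ x) := fun x => by
      rw [eq_neg_iff_add_eq_zero, add_comm, hdσ]
    rw [hR]
    refine directSum_ext ?_ ?_ <;> simp [B, hf', e1, e2, ← hf] <;> abel
  have hu : ∀ t, IsUnit (B + B.adjoint + R t) := fun t => by
    refine isUnit_add_of_isUnit_coneOperator (hRa t) (isUnit_coneOperator hB (hchain t) ?_)
    rw [hR]
    refine isQuasiIso_rotation hσ hdσ hf' hf hS q q' ?_
    have := Real.cos_sq_add_sin_sq t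
    rw [pow_two, pow_two] at this
    exact_mod_cast this
  have hsa : ∀ t, star (B + B.adjoint + R t) = B + B.adjoint + R t := fun t => by
    rw [star_eq_adjoint, adjoint_add, adjoint_add, adjoint_adjoint, hRa, add_comm B]
  have hcont : Continuous fun t => B + B.adjoint + R t := by
    have h1 : Continuous fun t : ℝ => (Real.cos t : ℂ) :=
      Complex.continuous_ofReal.comp Real.continuous_cos
    have h2 : Continuous fun t : ℝ => (Real.sin t : ℂ) :=
      Complex.continuous_ofReal.comp Real.continuous_sin
    exact continuous_const.add ((h1.smul continuous_const).add (h2.smul continuous_const))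
  have k₀ : IsSign (B + B.adjoint + R 0) (Adjointable.block s₀ 0 0 r₀) := by
    have e : B + B.adjoint + R 0 =
        Adjointable.block (b + b.adjoint + S) 0 0 (d + d.adjoint - σ) := by
      refine ext_apply fun v => directSum_ext ?_ ?_ <;> simp [R, B, X, sub_eq_add_neg]
    rw [e]
    exact hs₀.block hr₀
  have k₁ : IsSign (B + B.adjoint + R Real.pi) (Adjointable.block s₁ 0 0 r₁) := by
    have e : B + B.adjoint + R Real.pi =
        Adjointable.block (b + b.adjoint - S) 0 0 (d + d.adjoint + σ) := by
      refine ext_apply fun v => directSum_ext ?_ ?_ <;> simp [R, B, X, sub_eq_add_neg]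
    rw [e]
    exact hs₁.block hr₁
  rw [← signClass_block β γ hs₀.mul_self hr₀.mul_self k₀.mul_self,
    ← signClass_block β γ hs₁.mul_self hr₁.mul_self k₁.mul_self]
  exact IsSign.signClass_eq_of_homotopy _ _ hcont hsa hu k₀ k₁

/-- An invertible `σ` that anticommutes with the differentials is an isomorphism of complexes up to
sign, hence a duality. -/
theorem isUnit_add_involution [CompleteSpace F] {d σ : Adjointable C F F}
    (hd : ∀ x, d (d x) = 0) (hσa : σ.adjoint = σ) (hσ : σ * σ = 1)
    (hdσ : ∀ x, d (σ x) + σ (d.adjoint x) = 0) : IsUnit (d + d.adjoint + σ) := by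
  have hσx : ∀ x, σ (σ x) = x := fun x => congrArg (fun T : Adjointable C F F => T x) hσ
  have hdσ1 : ∀ x, σ (d x) = -d.adjoint (σ x) := fun x => by
    have := hdσ (σ x)
    rw [hσx] at this
    rw [eq_neg_iff_add_eq_zero, ← hσx (d.adjoint (σ x)), ← map_add, this, map_zero]
  refine isUnit_add_of_isUnit_coneOperator hσa (isUnit_coneOperator hd hdσ
    ⟨fun x y _ hy => ⟨-σ y, ?_⟩, fun y hy => ⟨σ y, 0, ?_, ?_⟩⟩)
  · rw [map_neg, ← hdσ1, ← hy, hσx]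
  · rw [← neg_eq_zero, ← hdσ1, hy, map_zero]
  · rw [hσx, map_zero, add_zero]

/-- If the duality is an isomorphism of modules, then the differential does not contribute. -/
theorem signClass_eq_of_involution [CompleteSpace F] {m : ℕ} (γ : DualBasis C F m)
    {d σ : Adjointable C F F} (hd : ∀ x, d (d x) = 0) (hσa : σ.adjoint = σ) (hσ : σ * σ = 1)
    (hdσ : ∀ x, d (σ x) + σ (d.adjoint x) = 0) {r : Adjointable C F F}
    (hr : IsSign (d + d.adjoint + σ) r) : signClass γ r hr.mul_self = signClass γ σ hσ := by
  -- Every multiple `t d` satisfies the same relations with `σ`, so the path stays invertible down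
  -- to `t = 0`, where the operator is `σ` and is its own sign.
  let D : ℝ → Adjointable C F F := fun t => (t : ℂ) • d + ((t : ℂ) • d).adjoint + σ
  have hcont : Continuous D := by
    have : D = fun t : ℝ => (t : ℂ) • d + (t : ℂ) • d.adjoint + σ := by
      funext t
      simp only [D, adjoint_smul, Complex.star_def, Complex.conj_ofReal]
    rw [this]
    exact ((Complex.continuous_ofReal.smul continuous_const).add
      (Complex.continuous_ofReal.smul continuous_const)).add continuous_const
  have hsa : ∀ t, star (D t) = D t := fun t => by
    simp only [D]
    rw [star_eq_adjoint, adjoint_add, adjoint_add, adjoint_adjoint, hσa, add_comm ((t : ℂ) • d)]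
  have hu : ∀ t, IsUnit (D t) := fun t => by
    refine isUnit_add_involution (fun x => ?_) hσa hσ fun x => ?_
    · simp only [Adjointable.smul_apply, map_smul, hd, smul_zero]
    · simp only [adjoint_smul, Complex.star_def, Complex.conj_ofReal, Adjointable.smul_apply,
        map_smul]
      rw [← smul_add, hdσ, smul_zero]
  have k₁ : IsSign (D 1) r := by simpa [D] using hr
  have k₀ : IsSign (D 0) σ := by
    have e : D 0 = σ := by
      refine ext_apply fun v => ?_
      simp [D]
    rw [e]
    exact ⟨hσa, hσ, 1, by rw [hσ, star_one, one_mul]⟩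
  exact IsSign.signClass_eq_of_homotopy γ D hcont hsa hu k₁ k₀

end Signature

section GradingSign

variable {C : Type*} [NonUnitalCStarAlgebra C] [PartialOrder C] [StarOrderedRing C]
  {E : Type*} [NormedAddCommGroup E] [NormedSpace ℂ E] [SMul C E] [CStarModule C E]

/-! ### The sign operator of a grading -/

theorem Grading.ext_proj {n : ℕ} (g : Grading C E n) {T U : Adjointable C E E}
    (h : ∀ k ≤ n, ∀ v, T (g.proj k v) = U (g.proj k v)) : T = U := by
  refine ext_apply fun v => ?_
  rw [← g.sum_proj v, map_sum, map_sum]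
  exact Finset.sum_congr rfl fun k hk => h k (Nat.lt_succ_iff.mp (Finset.mem_range.mp hk)) v

/-- The operator that is `(-1)ᵏ` in degree `k`. -/
noncomputable def Grading.sign {n : ℕ} (g : Grading C E n) : Adjointable C E E :=
  ∑ k ∈ Finset.range (n + 1), ((-1 : ℂ) ^ k) • g.proj k

theorem Grading.sign_proj {n : ℕ} (g : Grading C E n) (k : ℕ) (v : E) :
    g.sign (g.proj k v) = (-1 : ℂ) ^ k • g.proj k v := by
  have hsum : ∀ w, g.sign w = ∑ l ∈ Finset.range (n + 1), ((-1 : ℂ) ^ l) • g.proj l w := by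
    intro w
    let φ : Adjointable C E E →+ E :=
      { toFun := fun T => T w, map_zero' := rfl, map_add' := fun _ _ => rfl }
    exact map_sum φ _ _
  rw [hsum]
  by_cases hk : k ≤ n
  · rw [Finset.sum_eq_single_of_mem k (Finset.mem_range.mpr (Nat.lt_succ_of_le hk)), g.idem]
    intro l _ hl
    rw [g.orthogonal l k v hl, smul_zero]
  · rw [g.eq_zero_of_lt k v (not_le.mp hk), smul_zero]
    exact Finset.sum_eq_zero fun l _ => by rw [map_zero, smul_zero]

theorem Grading.star_sign {n : ℕ} (g : Grading C E n) : star g.sign = g.sign := by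
  rw [Grading.sign, star_sum]
  refine Finset.sum_congr rfl fun k _ => ?_
  rw [star_smul, star_eq_adjoint, g.selfAdjoint]
  congr 1
  simp

theorem Grading.sign_mul_sign {n : ℕ} (g : Grading C E n) : g.sign * g.sign = 1 := by
  refine g.ext_proj fun k _ v => ?_
  rw [Adjointable.mul_apply, g.sign_proj, map_smul, g.sign_proj, smul_smul, ← mul_pow]
  simp

theorem IsChainComplex.sign_mul {n : ℕ} {g : Grading C E n} {b : Adjointable C E E}
    (h : IsChainComplex g b) : g.sign * b = -(b * g.sign) := by
  refine g.ext_proj fun k _ v => ?_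
  rw [Adjointable.neg_apply, Adjointable.mul_apply, Adjointable.mul_apply, g.sign_proj, map_smul]
  cases k with
  | zero => simp [h.degree_zero]
  | succ k =>
    rw [h.degree_succ, g.sign_proj, pow_succ]
    module

/-- On degree `k` the two sides carry `(-1)ⁿ⁻ᵏ` and `(-1)ⁿ (-1)ᵏ`, which agree. -/
theorem HasDualityDegree.sign_mul {n : ℕ} {g : Grading C E n} {S : Adjointable C E E}
    (h : HasDualityDegree g S) : g.sign * S = (-1 : ℂ) ^ n • (S * g.sign) := by
  refine g.ext_proj fun k hk v => ?_
  have e : S (g.proj k v) = g.proj (n - k) (S v) := by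
    rw [← h (n - k) (Nat.sub_le n k), Nat.sub_sub_self hk]
  rw [Adjointable.smul_apply, Adjointable.mul_apply, Adjointable.mul_apply, g.sign_proj, map_smul,
    e, g.sign_proj, smul_smul]
  congr 1
  obtain ⟨l, rfl⟩ := Nat.exists_eq_add_of_le hk
  rw [Nat.add_sub_cancel_left, pow_add, mul_right_comm, ← mul_pow]
  simp

/-- If the positive eigenspaces of `b + b* + S` and `b + b* - S` have the same class, then so do the
positive and negative eigenspaces of `b + b* + S`. -/
theorem signClass_eq_neg [CompleteSpace E] {n m : ℕ} (β : DualBasis C E m) {g : Grading C E n}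
    {b S : Adjointable C E E} (hb : IsChainComplex g b) (hS : HasDualityDegree g S)
    (hSa : S.adjoint = S) (hu : IsUnit (coneOperator b S)) {s s' : Adjointable C E E}
    (hs : IsSign (b + b.adjoint + S) s) (hs' : IsSign (b + b.adjoint - S) s')
    (h : signClass β s hs.mul_self = signClass β s' hs'.mul_self) :
    signClass β s hs.mul_self = signClass β (-s) hs.neg.mul_self := by
  have hg := g.star_sign
  have hgg := g.sign_mul_sign
  have hconj : ∀ {t : Adjointable C E E} (ht : t * t = 1)
      (ht' : g.sign * t * g.sign * (g.sign * t * g.sign) = 1),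
      signClass β (g.sign * t * g.sign) ht' = signClass β t ht := fun {t} ht ht' => by
    refine signClass_eq_of_mul_eq β _ _ (g := g.sign) ⟨⟨_, _, hgg, hgg⟩, rfl⟩ ?_
    rw [mul_assoc, hgg, mul_one]
  have hu1 : IsUnit (-(b + b.adjoint + S)) := (isUnit_add_of_isUnit_coneOperator hSa hu).neg
  have e1 : g.sign * b * g.sign = -b := by
    rw [hb.sign_mul, neg_mul, mul_assoc, hgg, mul_one]
  have e2 : g.sign * b.adjoint * g.sign = -b.adjoint := by
    have := congrArg star e1
    rw [star_mul, star_mul, hg, star_neg, ← mul_assoc] at this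
    exact this
  have e3 : g.sign * S * g.sign = (-1 : ℂ) ^ n • S := by
    rw [hS.sign_mul, smul_mul_assoc, mul_assoc, hgg, mul_one]
  -- The grading sign reverses `b + b*` and multiplies `S` by `(-1)ⁿ`. For `n` even it carries `b +
  -- b* - S` to `-(b + b* + S)`, so `h` is needed; for `n` odd it carries `b + b* + S` to its own
  -- negative.
  rcases Nat.even_or_odd n with hn | hn
  · have e : g.sign * (b + b.adjoint - S) * g.sign = -(b + b.adjoint + S) := by
      rw [mul_sub, mul_add, sub_mul, add_mul, e1, e2, e3, hn.neg_one_pow, one_smul]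
      abel
    have k := hs'.conj hg hgg
    rw [e] at k
    rw [h, ← hconj hs'.mul_self k.mul_self]
    exact k.signClass_eq β hs.neg hu1
  · have e : g.sign * (b + b.adjoint + S) * g.sign = -(b + b.adjoint + S) := by
      rw [mul_add, mul_add, add_mul, add_mul, e1, e2, e3, hn.neg_one_pow, neg_one_smul]
      abel
    have k := hs.conj hg hgg
    rw [e] at k
    rw [← hconj hs.mul_self k.mul_self]
    exact k.signClass_eq β hs.neg hu1

end GradingSign

/-! ### Complexes with boundary -/

section Boundary

variable {C : Type*} [NonUnitalCStarAlgebra C] [PartialOrder C] [StarOrderedRing C]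
  {E : Type*} [NormedAddCommGroup E] [NormedSpace ℂ E] [SMul C E] [CStarModule C E]
  {E₀ : Type*} [NormedAddCommGroup E₀] [NormedSpace ℂ E₀] [SMul C E₀] [CStarModule C E₀]
  {E₁ : Type*} [NormedAddCommGroup E₁] [NormedSpace ℂ E₁] [SMul C E₁] [CStarModule C E₁]

/-- A dual basis of an orthogonal summand. -/
noncomputable def DualBasis.ofCoisometry {m : ℕ} (β : DualBasis C E m) (j : Adjointable C E E₁)
    (hj : ∀ v, j (j.adjoint v) = v) : DualBasis C E₁ m where
  x k := j (β.x k)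
  y k := j (β.y k)
  expand v := by
    conv_rhs => rw [← hj v, ← β.expand (j.adjoint v), map_sum]
    refine Finset.sum_congr rfl fun k _ => ?_
    rw [map_smul_alg, inner_adjoint_right]

/-- The differential of the boundary of the quotient complex, as a mapping cone. -/
noncomputable def quotientConeDifferential (b S : Adjointable C E E) (j : Adjointable C E E₁) :
    Adjointable C (WithCStarModule C (E₁ × E₁)) (WithCStarModule C (E₁ × E₁)) :=
  Adjointable.block (j.comp (b.comp j.adjoint)) (j.comp (S.comp j.adjoint)) 0
    (j.comp (b.adjoint.comp j.adjoint))

/-- The map from the boundary of the quotient complex to the boundary. -/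
noncomputable def coneToBoundary (b S : Adjointable C E E) (i : Adjointable C E₀ E)
    (j : Adjointable C E E₁) : Adjointable C (WithCStarModule C (E₁ × E₁)) E₀ :=
  (i.adjoint.comp (b.comp j.adjoint)).comp (inl C E₁ E₁).adjoint +
    (i.adjoint.comp (S.comp j.adjoint)).comp (inr C E₁ E₁).adjoint

/-- The symmetry exchanging the summands of `E ⊕ E`. -/
noncomputable def swap (C : Type*) [NonUnitalCStarAlgebra C] [PartialOrder C] [StarOrderedRing C]
    (E : Type*) [NormedAddCommGroup E] [NormedSpace ℂ E] [SMul C E] [CStarModule C E] :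
    Adjointable C (WithCStarModule C (E × E)) (WithCStarModule C (E × E)) :=
  Adjointable.block 0 (Adjointable.id C E) (Adjointable.id C E) 0

theorem swap_apply (v : WithCStarModule C (E × E)) : swap C E v = pair C v.2 v.1 :=
  directSum_ext (by simp [swap]) (by simp [swap])

theorem swap_mul_swap : swap C E * swap C E = 1 :=
  ext_apply fun v => directSum_ext (by simp [swap]) (by simp [swap])

/-- The involution `diag(1, -1)` anticommutes with the swap: the hyperbolic form is isomorphic to
its negative. -/
theorem signClass_swap {m : ℕ} (γ : DualBasis C (WithCStarModule C (E × E)) m)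
    (h : -swap C E * -swap C E = 1) :
    signClass γ (swap C E) swap_mul_swap = signClass γ (-swap C E) h := by
  let g := Adjointable.block (Adjointable.id C E) 0 0 (-Adjointable.id C E)
  have hg : g * g = 1 := ext_apply fun v => directSum_ext (by simp [g]) (by simp [g])
  refine signClass_eq_of_mul_eq γ _ _ (g := g) ⟨⟨g, g, hg, hg⟩, rfl⟩ ?_
  exact ext_apply fun v => directSum_ext (by simp [g, swap]) (by simp [g, swap])

/-! ### Identities for the inclusion, the quotient and the boundary duality -/

namespace IsHilbertPoincareComplexWithBoundary

variable {n : ℕ} {g : Grading C E (n + 1)} {b S : Adjointable C E E} {g₀ : Grading C E₀ n}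
  {b₀ : Adjointable C E₀ E₀} {i : Adjointable C E₀ E} {j : Adjointable C E E₁}

theorem quotient_inclusion (h : IsHilbertPoincareComplexWithBoundary g b S g₀ b₀ i j) (e : E₀) :
    j (i e) = 0 := by
  have h1 := h.decomposition (i e)
  rw [h.isometry, add_eq_left] at h1
  rw [← h.coisometry (j (i e)), h1, map_zero]

theorem inclusion_adjoint_quotient_adjoint
    (h : IsHilbertPoincareComplexWithBoundary g b S g₀ b₀ i j) (y : E₁) :
    i.adjoint (j.adjoint y) = 0 := by
  have h1 := h.decomposition (j.adjoint y)
  rw [h.coisometry, add_eq_right] at h1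
  rw [← h.isometry (i.adjoint (j.adjoint y)), h1, map_zero]

theorem inclusion_injective (h : IsHilbertPoincareComplexWithBoundary g b S g₀ b₀ i j)
    {e e' : E₀} (hee : i e = i e') : e = e' := by
  rw [← h.isometry e, hee, h.isometry]

/-- `b S + S b*` is self-adjoint with range in `E₀`, so it vanishes on the orthogonal complement
`E₁`. -/
theorem adjoint_chain (h : IsHilbertPoincareComplexWithBoundary g b S g₀ b₀ i j) (y : E₁) :
    b (S (j.adjoint y)) + S (b.adjoint (j.adjoint y)) = 0 := by
  refine eq_of_inner_right C fun w => ?_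
  have h1 : inner C (j (b (S w) + S (b.adjoint w))) y = 0 := by
    rw [h.chain, CStarModule.inner_zero_left]
  have hS : ∀ u v : E, inner C (S u) v = inner C u (S v) := fun u v => by
    rw [← inner_adjoint_right, h.selfAdjoint]
  rw [← inner_adjoint_right, CStarModule.inner_add_left, ← inner_adjoint_right, hS, hS,
    inner_adjoint, ← CStarModule.inner_add_right, add_comm] at h1
  rw [h1, CStarModule.inner_zero_right]

theorem chain_inclusion (h : IsHilbertPoincareComplexWithBoundary g b S g₀ b₀ i j) (x : E) :
    b (S (i (i.adjoint x))) + S (b.adjoint (i (i.adjoint x))) = b (S x) + S (b.adjoint x) := by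
  conv_rhs => rw [← h.decomposition x]
  have h1 := h.adjoint_chain (j x)
  simp only [map_add]
  rw [add_add_add_comm, h1, add_zero]

theorem quotient_differential (h : IsHilbertPoincareComplexWithBoundary g b S g₀ b₀ i j) (x : E) :
    j (b x) = j (b (j.adjoint (j x))) := by
  conv_lhs => rw [← h.decomposition x, map_add, ← h.inclusion_chain, map_add, h.quotient_inclusion,
    zero_add]

theorem inclusion_adjoint_differential_adjoint
    (h : IsHilbertPoincareComplexWithBoundary g b S g₀ b₀ i j) (x : E) :
    i.adjoint (b.adjoint x) = b₀.adjoint (i.adjoint x) := by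
  refine eq_of_inner_right C fun w => ?_
  rw [inner_adjoint_right, inner_adjoint_right, inner_adjoint_right, inner_adjoint_right,
    h.inclusion_chain]

theorem differential_adjoint_quotient_adjoint
    (h : IsHilbertPoincareComplexWithBoundary g b S g₀ b₀ i j) (y : E₁) :
    b.adjoint (j.adjoint y) = j.adjoint (j (b.adjoint (j.adjoint y))) := by
  conv_lhs => rw [← h.decomposition (b.adjoint (j.adjoint y)),
    h.inclusion_adjoint_differential_adjoint, h.inclusion_adjoint_quotient_adjoint, map_zero,
    map_zero, zero_add]

theorem inclusion_boundaryDuality (h : IsHilbertPoincareComplexWithBoundary g b S g₀ b₀ i j)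
    (e : E₀) : i (boundaryDuality b S i e) = b (S (i e)) + S (b.adjoint (i e)) := by
  have h1 := h.decomposition (b (S (i e)) + S (b.adjoint (i e)))
  rw [h.chain, map_zero, add_zero] at h1
  exact h1

theorem boundaryDuality_adjoint (h : IsHilbertPoincareComplexWithBoundary g b S g₀ b₀ i j) :
    (boundaryDuality b S i).adjoint = boundaryDuality b S i := by
  refine ext_apply fun e => ?_
  simp only [boundaryDuality, adjoint_comp, adjoint_add, adjoint_adjoint, h.selfAdjoint,
    Adjointable.comp_apply, Adjointable.add_apply, add_comm]

/-- Both sides equal `b S b*` after inclusion into `E`. They commute where a Poincaré complex needs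
anticommutation, which is why `b₀` is multiplied by `√-1`. -/
theorem boundaryDuality_chain (h : IsHilbertPoincareComplexWithBoundary g b S g₀ b₀ i j)
    (e : E₀) :
    b₀ (boundaryDuality b S i e) = boundaryDuality b S i (b₀.adjoint e) := by
  refine h.inclusion_injective ?_
  have h1 : b₀.adjoint e = i.adjoint (b.adjoint (i e)) := by
    rw [h.inclusion_adjoint_differential_adjoint, h.isometry]
  rw [h.inclusion_chain, h.inclusion_boundaryDuality, h.inclusion_boundaryDuality, h1,
    h.chain_inclusion, map_add, h.complex.sq_zero, zero_add, adjoint_sq_zero h.complex.sq_zero,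
    map_zero, add_zero]

theorem hasDualityDegree_boundaryDuality
    (h : IsHilbertPoincareComplexWithBoundary g b S g₀ b₀ i j) :
    HasDualityDegree g₀ (boundaryDuality b S i) := by
  intro k hk v
  have hb : ∀ l v, g.proj (l + 1) (b.adjoint v) = b.adjoint (g.proj l v) := fun l v => by
    refine eq_of_inner_right C fun w => ?_
    have h1 : ∀ l (x y : E), inner C x (g.proj l y) = inner C (g.proj l x) y := fun l x y => by
      rw [← inner_adjoint_right, g.selfAdjoint]
    rw [h1, inner_adjoint_right, inner_adjoint_right, h.complex.degree_succ, h1]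
  have hS : ∀ l ≤ n + 1, ∀ l', l + l' = n + 1 → ∀ v, S (g.proj l' v) = g.proj l (S v) := by
    intro l hl l' hll v
    rw [← h.degree l hl, show n + 1 - l = l' by omega]
  refine h.inclusion_injective ?_
  -- In dimension `n + 1`, `S` sends degree `n - k` to `k + 1`, and `b` lowers this to `k`; `b*`
  -- raises `n - k` to `n - k + 1`, which `S` sends to `k`.
  rw [h.inclusion_boundaryDuality, h.inclusion_degree, h.inclusion_degree,
    h.inclusion_boundaryDuality, ← hb, hS (k + 1) (by omega) (n - k) (by omega),
    hS k (by omega) (n - k + 1) (by omega), h.complex.degree_succ, map_add]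

/-- The quotient cone is built from `b₁`, `b₁*` and `j S j*`. Since `S j*` identifies the homology
of `(E₁, b₁*)` with that of `(E, b)`, it is a model for the cone of `E → E / E₀`, whose homology is
that of `E₀` up to a shift. -/
theorem isQuasiIso_coneToBoundary [CompleteSpace E] [CompleteSpace E₁]
    (h : IsHilbertPoincareComplexWithBoundary g b S g₀ b₀ i j) :
    IsQuasiIso (quotientConeDifferential b S j) b₀ (coneToBoundary b S i j) := by
  have hd : ∀ y, j (b (j.adjoint (j (b (j.adjoint y))))) = 0 := fun y => by
    rw [← h.quotient_differential, h.complex.sq_zero, map_zero]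
  -- The adjoint of the duality `j S`; the sign makes `j S` a chain map before dualizing and is
  -- removed afterwards.
  have q : IsQuasiIso (j.comp (b.adjoint.comp j.adjoint)) b (S.comp j.adjoint) := by
    have q1 := h.duality.isQuasiIso.neg_left.adjoint (fun v => ?_) (fun v => hd v) (fun v => ?_)
    · have e : (-b.adjoint).adjoint = (-1 : ℂ) • b := by
        refine ext_apply fun x => ?_
        simp
      have e0 : (j.comp S).adjoint = S.comp j.adjoint := by rw [adjoint_comp, h.selfAdjoint]
      rw [e, e0] at q1
      have q2 := q1.smul (z := 1) (w := -1) one_ne_zero (by norm_num)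
      have e1 : (-1 : ℂ) • (-1 : ℂ) • b = b := ext_apply fun x => by simp
      have e2 : (1 : ℂ) • (j.comp (b.comp j.adjoint)).adjoint =
          j.comp (b.adjoint.comp j.adjoint) := ext_apply fun x => by simp
      rwa [e1, e2] at q2
    · simp [adjoint_sq_zero h.complex.sq_zero]
    · have h1 := h.chain v
      simp only [Adjointable.comp_apply, Adjointable.neg_apply, map_neg]
      rw [← h.quotient_differential, neg_eq_iff_add_eq_zero, add_comm, ← map_add, h1]
  refine ⟨fun v e hv hve => ?_, fun e he => ?_⟩
  · have hv1 : j (b (j.adjoint v.1)) + j (S (j.adjoint v.2)) = 0 := congrArg Prod.fst hv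
    have hv2 : j (b.adjoint (j.adjoint v.2)) = 0 := by
      simpa [quotientConeDifferential] using congrArg Prod.snd hv
    have hve' : i.adjoint (b (j.adjoint v.1)) + i.adjoint (S (j.adjoint v.2)) = b₀ e := hve
    have e1 : b (j.adjoint v.1) + S (j.adjoint v.2) = b (i e) := by
      rw [← h.decomposition (b (j.adjoint v.1) + S (j.adjoint v.2)), map_add i.adjoint.op,
        map_add j.op, hv1, hve', map_zero, add_zero, h.inclusion_chain]
    obtain ⟨u, hu⟩ := q.inj v.2 (i e - j.adjoint v.1) hv2
      (by rw [map_sub, ← e1, add_sub_cancel_left]; rfl)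
    have hu' : v.2 = j (b.adjoint (j.adjoint u)) := hu
    have e2 : S (j.adjoint v.2) = -b (S (j.adjoint u)) := by
      rw [hu', ← h.differential_adjoint_quotient_adjoint, eq_neg_iff_add_eq_zero, add_comm,
        h.adjoint_chain]
    -- Since `v₂ = b₁* u`, this element is a cycle of `b`. Applying `j` to its decomposition
    -- expresses `v₁` through `z` and `u - x`, which yields the preimage `(-j z, u - x)`.
    obtain ⟨x, z, hx, hz⟩ := q.surj (i e - j.adjoint v.1 + S (j.adjoint u))
      (by rw [map_add, map_sub, ← e1, e2]; abel)
    have hz' : i e - j.adjoint v.1 + S (j.adjoint u) = S (j.adjoint x) + b z := hz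
    have hx' : j (b.adjoint (j.adjoint x)) = 0 := hx
    have e3 := congrArg j hz'
    rw [map_add, map_sub, map_add, h.quotient_inclusion, h.coisometry,
      h.quotient_differential z] at e3
    refine ⟨pair C (-j z) (u - x), directSum_ext ?_ ?_⟩
    · simp only [quotientConeDifferential, block_fst, pair_fst, pair_snd, Adjointable.comp_apply,
        map_neg, map_sub]
      rw [zero_sub, neg_add_eq_sub, sub_eq_iff_eq_add] at e3
      rw [eq_comm, ← sub_eq_zero]
      rw [e3]
      abel
    · simp [quotientConeDifferential, hx', ← hu']
  · obtain ⟨x, z, hx, hz⟩ := q.surj (i e) (by rw [← h.inclusion_chain, he, map_zero])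
    have hz' : i e = S (j.adjoint x) + b z := hz
    have hx' : j (b.adjoint (j.adjoint x)) = 0 := hx
    refine ⟨pair C (j z) x, i.adjoint z, directSum_ext ?_ ?_, ?_⟩
    · simp only [quotientConeDifferential, block_fst, pair_fst, pair_snd, Adjointable.comp_apply,
        directSum_zero_fst]
      rw [← h.quotient_differential, add_comm, ← map_add, ← hz', h.quotient_inclusion]
    · simp [quotientConeDifferential, hx']
    · change e = i.adjoint (b (j.adjoint (j z))) + i.adjoint (S (j.adjoint x)) + b₀ (i.adjoint z)
      refine h.inclusion_injective ?_
      rw [← h.isometry (b₀ (i.adjoint z)), h.inclusion_chain, add_right_comm, ← map_add, ← map_add,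
        ← map_add, add_comm (j.adjoint _), h.decomposition, add_comm (b z), ← hz', h.isometry]

/-- Replacing `j* j` by `1 - i i*` leaves `i* (b S + S b*) j*`, which vanishes by `adjoint_chain`,
and a term `-b₀ f`. -/
theorem coneToBoundary_chain (h : IsHilbertPoincareComplexWithBoundary g b S g₀ b₀ i j)
    (v : WithCStarModule C (E₁ × E₁)) :
    coneToBoundary b S i j (quotientConeDifferential b S j v) =
      -b₀ (coneToBoundary b S i j v) := by
  change i.adjoint (b (j.adjoint (j (b (j.adjoint v.1)) + j (S (j.adjoint v.2))))) +
      i.adjoint (S (j.adjoint ((0 : Adjointable C E₁ E₁) v.1 + j (b.adjoint (j.adjoint v.2))))) =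
    -b₀ (i.adjoint (b (j.adjoint v.1)) + i.adjoint (S (j.adjoint v.2)))
  have hb : ∀ x, b (j.adjoint (j x)) = b x - i (b₀ (i.adjoint x)) := fun x => by
    rw [h.inclusion_chain, ← map_sub]
    nth_rw 2 [← h.decomposition x]
    rw [add_sub_cancel_left]
  have h1 := h.adjoint_chain v.2
  rw [Adjointable.zero_apply, zero_add, ← h.differential_adjoint_quotient_adjoint,
    ← map_add j.op, hb, map_add b.op, h.complex.sq_zero, zero_add, ← map_add i.adjoint.op,
    sub_add_eq_add_sub, h1, zero_sub, map_neg, h.isometry, map_add i.adjoint.op]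

theorem quotientConeDifferential_sq_zero
    (h : IsHilbertPoincareComplexWithBoundary g b S g₀ b₀ i j)
    (v : WithCStarModule C (E₁ × E₁)) :
    quotientConeDifferential b S j (quotientConeDifferential b S j v) = 0 := by
  refine directSum_ext ?_ ?_
  · simp only [quotientConeDifferential, block_fst, block_snd, Adjointable.comp_apply,
      Adjointable.zero_apply, zero_add, directSum_zero_fst]
    rw [← h.differential_adjoint_quotient_adjoint, ← map_add j.op (b (j.adjoint v.1)),
      ← h.quotient_differential, map_add b.op, h.complex.sq_zero, zero_add, ← map_add, h.adjoint_chain, map_zero]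
  · simp only [quotientConeDifferential, block_snd, Adjointable.comp_apply,
      Adjointable.zero_apply, zero_add, directSum_zero_snd]
    rw [← h.differential_adjoint_quotient_adjoint, adjoint_sq_zero h.complex.sq_zero, map_zero]

theorem quotientConeDifferential_swap
    (h : IsHilbertPoincareComplexWithBoundary g b S g₀ b₀ i j)
    (v : WithCStarModule C (E₁ × E₁)) :
    quotientConeDifferential b S j (swap C E₁ v) =
      swap C E₁ ((quotientConeDifferential b S j).adjoint v) := by
  rw [swap_apply, swap_apply]
  refine directSum_ext ?_ ?_
  · simp [quotientConeDifferential, h.selfAdjoint, add_comm]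
  · simp [quotientConeDifferential]

/-- In `i* b S i` and `i* S b* i` the identity `i i* + j* j` is inserted between the two factors:
the `j* j` parts form `f σ f*`, the `i i*` parts give the homotopy terms with `i* S i`. -/
theorem boundaryDuality_eq (h : IsHilbertPoincareComplexWithBoundary g b S g₀ b₀ i j) (e : E₀) :
    boundaryDuality b S i e =
      coneToBoundary b S i j (swap C E₁ ((coneToBoundary b S i j).adjoint e)) +
        b₀ (i.adjoint (S (i e))) + i.adjoint (S (i (b₀.adjoint e))) := by
  have h1 : ∀ x, i (i.adjoint x) = x - j.adjoint (j x) := fun x => by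
    rw [eq_sub_iff_add_eq, h.decomposition]
  have h2 : b₀.adjoint e = i.adjoint (b.adjoint (i e)) := by
    rw [h.inclusion_adjoint_differential_adjoint, h.isometry]
  have h3 : ∀ x, b₀ (i.adjoint x) = i.adjoint (b x) - i.adjoint (b (j.adjoint (j x))) := fun x => by
    rw [← h.isometry (b₀ _), h.inclusion_chain, h1, map_sub, map_sub]
  rw [swap_apply, h2, h3, h1]
  have h4 : (coneToBoundary b S i j).adjoint e =
      pair C (j (b.adjoint (i e))) (j (S (i e))) := by
    refine directSum_ext ?_ ?_ <;> simp [coneToBoundary, h.selfAdjoint]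
  rw [h4]
  simp only [boundaryDuality, coneToBoundary, Adjointable.comp_apply, Adjointable.add_apply,
    inl_adjoint_apply, inr_adjoint_apply, pair_fst, pair_snd, map_add, map_sub]
  abel

end IsHilbertPoincareComplexWithBoundary

end Boundary

/-- The boundary of a Hilbert–Poincaré complex with boundary is a Hilbert–Poincaré complex with
vanishing signatures. -/
theorem IsHilbertPoincareComplexWithBoundary.boundary_signature
    {C : Type*} [NonUnitalCStarAlgebra C] [PartialOrder C] [StarOrderedRing C]
    {E : Type*} [NormedAddCommGroup E] [NormedSpace ℂ E] [CompleteSpace E] [SMul C E]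
    [CStarModule C E]
    {E₀ : Type*} [NormedAddCommGroup E₀] [NormedSpace ℂ E₀] [CompleteSpace E₀] [SMul C E₀]
    [CStarModule C E₀]
    {E₁ : Type*} [NormedAddCommGroup E₁] [NormedSpace ℂ E₁] [CompleteSpace E₁] [SMul C E₁]
    [CStarModule C E₁]
    {n : ℕ} {g : Grading C E (n + 1)} {b S : Adjointable C E E}
    {g₀ : Grading C E₀ n} {b₀ : Adjointable C E₀ E₀}
    {i : Adjointable C E₀ E} {j : Adjointable C E E₁}
    (h : IsHilbertPoincareComplexWithBoundary g b S g₀ b₀ i j) :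
    IsHilbertPoincareComplex g₀ (Complex.I • b₀) (boundaryDuality b S i) ∧
    HasMishchenkoSignature (Complex.I • b₀) (boundaryDuality b S i) 0 ∧
    (Even n → HasHigsonRoeSignature (Complex.I • b₀) (boundaryDuality b S i) 0) := by
  set S₀ := boundaryDuality b S i with hS₀
  set d := quotientConeDifferential b S j with hd
  set f := coneToBoundary b S i j with hf
  obtain ⟨m₀, ⟨β⟩⟩ := h.boundary_complex.isFGProjective
  obtain ⟨m, ⟨γ⟩⟩ := h.complex.isFGProjective
  have γ' := (γ.ofCoisometry j h.coisometry).directSum (γ.ofCoisometry j h.coisometry)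
  have hI : Complex.I ≠ 0 := Complex.I_ne_zero
  have hSa : S₀.adjoint = S₀ := h.boundaryDuality_adjoint
  have hcplx : IsChainComplex g₀ (Complex.I • b₀) :=
    ⟨h.boundary_complex.isFGProjective,
      fun v => by rw [Adjointable.smul_apply, h.boundary_complex.degree_zero, smul_zero],
      fun k v => by
        rw [Adjointable.smul_apply, Adjointable.smul_apply, map_smul,
          h.boundary_complex.degree_succ],
      fun v => by simp [h.boundary_complex.sq_zero]⟩
  have hdd : ∀ v, ((-Complex.I) • d) (((-Complex.I) • d) v) = 0 := fun v => by
    simp [hd, h.quotientConeDifferential_sq_zero]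
  have hchain : ∀ v, (Complex.I • b₀) (S₀ v) + S₀ ((Complex.I • b₀).adjoint v) = 0 := fun v => by
    simp [hS₀, h.boundaryDuality_chain]
  have hσ : ∀ v, swap C E₁ (swap C E₁ v) = v := fun v =>
    congrArg (fun T : Adjointable C (WithCStarModule C (E₁ × E₁)) _ => T v) swap_mul_swap
  have hσa : (swap C E₁).adjoint = swap C E₁ := rfl
  have hdσ : ∀ v, ((-Complex.I) • d) (swap C E₁ v) +
      swap C E₁ (((-Complex.I) • d).adjoint v) = 0 := fun v => by
    simp [hd, h.quotientConeDifferential_swap]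
  have hfd : ∀ v, f (((-Complex.I) • d) v) = (Complex.I • b₀) (f v) := fun v => by
    simp [hd, hf, h.coneToBoundary_chain]
  have hfd' : ∀ v, f.adjoint ((Complex.I • b₀).adjoint v) =
      ((-Complex.I) • d).adjoint (f.adjoint v) := fun v => eq_of_inner_right C fun w => by
    rw [inner_adjoint_right, inner_adjoint_right, inner_adjoint_right, inner_adjoint_right, hfd]
  -- The homotopies are `∓√-1 i* S i`; their scalars cancel those of `√-1 b₀` and its adjoint.
  have hSt : ∀ v, S₀ v = f (swap C E₁ (f.adjoint v)) +
      (Complex.I • b₀) (((-Complex.I) • i.adjoint.comp (S.comp i)) v) +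
      (Complex.I • i.adjoint.comp (S.comp i)) ((Complex.I • b₀).adjoint v) := fun v => by
    rw [hS₀, h.boundaryDuality_eq]
    simp [smul_smul, hf]
  have q : IsQuasiIso ((-Complex.I) • d) (Complex.I • b₀) f :=
    h.isQuasiIso_coneToBoundary.smul (neg_ne_zero.mpr hI) hI
  have q' := q.adjoint hdd hcplx.sq_zero hfd
  have qS := isQuasiIso_of_transport hσ hdσ hfd' hfd hSt q q'
  have hdeg : HasDualityDegree g₀ S₀ := h.hasDualityDegree_boundaryDuality
  have hPC : IsHilbertPoincareComplex g₀ (Complex.I • b₀) S₀ := by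
    refine ⟨hcplx, hSa, hdeg, hchain, qS.inducesHomologyIso (A' := -S₀) (fun x => ?_) fun x => ?_⟩
    · rw [Adjointable.neg_apply, eq_neg_iff_add_eq_zero, hchain]
    · rw [Adjointable.neg_apply, map_neg, eq_neg_iff_add_eq_zero, add_comm, hchain]
  have hu := isUnit_coneOperator hcplx.sq_zero hchain qS
  have hs := exists_isSign (D := Complex.I • b₀ + (Complex.I • b₀).adjoint + S₀)
    (by rw [star_eq_adjoint, adjoint_add, adjoint_add, adjoint_adjoint, hSa,
      add_comm (Complex.I • b₀)])
    (isUnit_add_of_isUnit_coneOperator hSa hu)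
  have hs' := exists_isSign (D := Complex.I • b₀ + (Complex.I • b₀).adjoint - S₀)
    (by rw [star_eq_adjoint, adjoint_sub, adjoint_add, adjoint_adjoint, hSa,
      add_comm (Complex.I • b₀)])
    (isUnit_sub_of_isUnit_coneOperator hSa hu)
  obtain ⟨s, hs⟩ := hs
  obtain ⟨s', hs'⟩ := hs'
  have hσn : -swap C E₁ * -swap C E₁ = 1 := by rw [neg_mul_neg, swap_mul_swap]
  have hdσn : ∀ v, ((-Complex.I) • d) ((-swap C E₁) v) +
      (-swap C E₁) (((-Complex.I) • d).adjoint v) = 0 := fun v => by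
    rw [Adjointable.neg_apply, Adjointable.neg_apply, map_neg, ← neg_add, hdσ, neg_zero]
  have hσna : (-swap C E₁).adjoint = -swap C E₁ := rfl
  have hsym : star ((-Complex.I) • d + ((-Complex.I) • d).adjoint) =
      (-Complex.I) • d + ((-Complex.I) • d).adjoint := by
    rw [star_eq_adjoint, adjoint_add, adjoint_adjoint, add_comm]
  obtain ⟨r₁, hr₁⟩ := exists_isSign
    (D := (-Complex.I) • d + ((-Complex.I) • d).adjoint + swap C E₁)
    (by rw [star_add, hsym, star_eq_adjoint, hσa])
    (isUnit_add_involution hdd hσa swap_mul_swap hdσ)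
  obtain ⟨r₀, hr₀⟩ := exists_isSign
    (D := (-Complex.I) • d + ((-Complex.I) • d).adjoint + -swap C E₁)
    (by rw [star_add, hsym, star_eq_adjoint, hσna])
    (isUnit_add_involution hdd hσna hσn hdσn)
  have c₁ := signClass_eq_of_involution γ' hdd hσa swap_mul_swap hdσ hr₁
  have c₀ := signClass_eq_of_involution γ' hdd hσna hσn hdσn hr₀
  -- The signature operators of the hyperbolic complex for `σ` and `-σ` have positive eigenspaces of
  -- equal class; these two terms cancel in `key`, because `K₀` is a group.
  rw [← signClass_swap, ← c₁] at c₀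
  rw [← sub_eq_add_neg] at hr₀
  have key := signClass_add_eq_of_transport β γ' hcplx.sq_zero hdd hSa hσa hchain hσ hdσ hfd' hfd
    hSt q q' hs hs' hr₀ hr₁
  rw [c₀] at key
  have hss := add_right_cancel key
  exact ⟨hPC, hasMishchenkoSignature_zero β hSa hu hs hs.neg
    (signClass_eq_neg β hcplx hdeg hSa hu hs hs' hss),
    fun _ => hasHigsonRoeSignature_zero β hSa hu hs hs' hss⟩

end HilbertPoincare

open HilbertPoincare in
theorem theorem4p2 {C : Type*} [NonUnitalCStarAlgebra C] [PartialOrder C] [StarOrderedRing C]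
    {E : Type*} [NormedAddCommGroup E] [NormedSpace ℂ E] [CompleteSpace E] [SMul C E]
    [CStarModule C E]
    {E₀ : Type*} [NormedAddCommGroup E₀] [NormedSpace ℂ E₀] [CompleteSpace E₀] [SMul C E₀]
    [CStarModule C E₀]
    {E₁ : Type*} [NormedAddCommGroup E₁] [NormedSpace ℂ E₁] [CompleteSpace E₁] [SMul C E₁]
    [CStarModule C E₁]
    {n : ℕ} (g : Grading C E (n + 1)) (b S : Adjointable C E E)
    (g₀ : Grading C E₀ n) (b₀ : Adjointable C E₀ E₀)
    (i : Adjointable C E₀ E) (j : Adjointable C E E₁)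
    (h : IsHilbertPoincareComplexWithBoundary g b S g₀ b₀ i j) :
    IsHilbertPoincareComplex g₀ (Complex.I • b₀) (boundaryDuality b S i) ∧
    HasMishchenkoSignature (Complex.I • b₀) (boundaryDuality b S i) 0 ∧
    (Even n → HasHigsonRoeSignature (Complex.I • b₀) (boundaryDuality b S i) 0) :=
  h.boundary_signature
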